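/- Let $k$ be a field of characteristic zero, and let $\mathcal T_k$ be the free $k$-linear tensor category on one object $X$: its objects are the finitely supported families $(V_n)_{n\ge 0}$ of finite-dimensional representations $V_n$ of the symmetric groups $S_n$ over $k$, and the tensor product of a representation $V$ of $S_m$ and a representation $W$ of $S_n$ is the representation $\mathrm{Ind}_{S_m\times S_n}^{S_{m+n}}(V\otimes W)$ of $S_{m+n}$. Its Grothendieck ring $$K_0(\mathcal T_k)=\bigoplus_{n\ge 0}K_0(k[S_n]\text{-mod})$$ is a commutative ring graded by $n$. Let $x=[X]$ be the class of the trivial representation of $S_1$, and let $\lambda^n x$ be the class of the sign representation of $S_n$. The simple objects of $\mathcal T_k$ are the irreducible representations of the groups $S_n$; up to isomorphism they are the objects $S^\mu X$ labelled by the partitions $\mu$, and $s^\mu x=[S^\mu X]$ denotes their classes. Let $f:K_0(\mathcal T_k)\to K_0(\mathcal T_k)$ be a graded ring homomorphism (it maps the degree $n$ part to the degree $n$ part for every $n$) such that $f(x)=x$, $f(\lambda^2x)=\lambda^2x$, and for every partition $\mu$ $$f(s^\mu x)=\sum_\nu n_{\mu,\nu}\,s^\nu x$$ is a finite linear combination of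 the classes of simple objects with integers $n_{\mu,\nu}\ge 0$. Then $f$ is the identity. -/

import Mathlib

universe u

noncomputable section

namespace FreeTensor

open Representation
open scoped TensorProduct

section Induction

variable {k G H : Type*} [Field k] [Group G] [Group H] (φ : G →* H)
  {A B : Type*} [AddCommGroup A] [Module k A] (ρ : Representation k G A)
  [AddCommGroup B] [Module k B] (τ : Representation k H B)

theorem ind_mk_one (g : G) (a : A) :
    ind φ ρ (φ g) (IndV.mk φ ρ 1 a) = IndV.mk φ ρ 1 (ρ g a) := by
  rw [ind_mk, one_mul]
  have h := Coinvariants.mk_self_apply (ρ := Representation.tprod ((leftRegular k H).comp φ) ρ) g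
    ((MonoidAlgebra.single (φ g)⁻¹ (1 : k)) ⊗ₜ[k] a)
  rw [Representation.tprod_apply, TensorProduct.map_tmul] at h
  simp only [MonoidHom.coe_comp, Function.comp_apply] at h
  simpa using h.symm

theorem ind_induction {P : IndV φ ρ → Prop} (h0 : P 0) (hadd : ∀ x y, P x → P y → P (x + y))
    (h1 : ∀ h a, P (ind φ ρ h (IndV.mk φ ρ 1 a))) (z : IndV φ ρ) : P z := by
  induction z using Coinvariants.induction_on with
  | h v =>
    induction v using TensorProduct.induction_on with
    | zero => simpa using h0
    | add x y hx hy => rw [map_add]; exact hadd _ _ hx hy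
    | tmul x a =>
      induction x using MonoidAlgebra.induction_linear with
      | zero => simpa using h0
      | add x y hx hy => rw [TensorProduct.add_tmul, map_add]; exact hadd _ _ hx hy
      | single h r =>
        have := h1 h⁻¹ (r • a)
        rw [ind_mk, one_mul, inv_inv] at this
        have e : MonoidAlgebra.single h r ⊗ₜ[k] a
            = MonoidAlgebra.single h (1 : k) ⊗ₜ[k] (r • a) := by
          rw [← TensorProduct.smul_tmul]; simp
        rw [e]; exact this

/-- The universal property of induction. -/
def indLift (b : A →ₗ[k] B) (hb : ∀ g a, b (ρ g a) = τ (φ g) (b a)) : IndV φ ρ →ₗ[k] B :=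
  Coinvariants.lift _
    (TensorProduct.lift <| (Finsupp.lift _ _ _ fun h => τ h⁻¹ ∘ₗ b) ∘ₗ
      (MonoidAlgebra.coeffLinearEquiv k).toLinearMap)
    fun g ↦ by
      ext h x
      simp [ofMulAction_single, mul_inv_rev, hb]

theorem indLift_ind (b : A →ₗ[k] B) (hb : ∀ g a, b (ρ g a) = τ (φ g) (b a)) (h : H) (a : A) :
    indLift φ ρ τ b hb (ind φ ρ h (IndV.mk φ ρ 1 a)) = τ h (b a) := by
  rw [ind_mk]
  simp [indLift]

theorem indLift_one (b : A →ₗ[k] B) (hb : ∀ g a, b (ρ g a) = τ (φ g) (b a)) (a : A) :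
    indLift φ ρ τ b hb (IndV.mk φ ρ 1 a) = b a := by
  simp [indLift]

theorem indLift_equivariant (b : A →ₗ[k] B) (hb : ∀ g a, b (ρ g a) = τ (φ g) (b a)) (h : H)
    (z : IndV φ ρ) : indLift φ ρ τ b hb (ind φ ρ h z) = τ h (indLift φ ρ τ b hb z) := by
  induction z using ind_induction with
  | h0 => simp
  | hadd x y hx hy => simp only [map_add, hx, hy]
  | h1 h' a => rw [← Module.End.mul_apply, ← map_mul, indLift_ind, indLift_ind]; simp

end Induction

section Product

variable {k : Type*} [Field k]

/-- The outer tensor product of representations of `G` and `H`, a representation of `G × H`. -/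
def outer {G H A B : Type*} [Group G] [Group H] [AddCommGroup A] [Module k A] [AddCommGroup B]
    [Module k B] (ρ : Representation k G A) (σ : Representation k H B) :
    Representation k (G × H) (A ⊗[k] B) :=
  Representation.tprod (ρ.comp (MonoidHom.fst G H)) (σ.comp (MonoidHom.snd G H))

section

variable {G H K A B X : Type*} [Group G] [Group H] [Group K] [AddCommGroup A] [Module k A]
  [AddCommGroup B] [Module k B] [AddCommGroup X] [Module k X]
  (φ : G × H →* K) (ρ : Representation k G A) (σ : Representation k H B)
  (τ : Representation k K X)

theorem outer_tmul (g : G × H) (a : A) (b : B) :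
    outer ρ σ g (a ⊗ₜ b) = ρ g.1 a ⊗ₜ σ g.2 b := rfl

/-- The module underlying the induction along `φ` of an outer tensor product. -/
def IndProd : Type _ := IndV φ (outer ρ σ)

instance : AddCommGroup (IndProd φ ρ σ) := inferInstanceAs (AddCommGroup (IndV φ (outer ρ σ)))

instance : Module k (IndProd φ ρ σ) := inferInstanceAs (Module k (IndV φ (outer ρ σ)))

instance [Finite K] [Module.Finite k A] [Module.Finite k B] : Module.Finite k (IndProd φ ρ σ) :=
  inferInstanceAs (Module.Finite k (IndV φ (outer ρ σ)))

/-- The representation of `K` induced along `φ : G × H → K` from the outer tensor product of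
a representation of `G` and a representation of `H`. -/
def indProd : Representation k K (IndProd φ ρ σ) := ind φ (outer ρ σ)

/-- The universal bilinear map to the induction of an outer tensor product. -/
def indPair : A →ₗ[k] B →ₗ[k] IndProd φ ρ σ :=
  (TensorProduct.mk k A B).compr₂ (IndV.mk φ (outer ρ σ) 1)

theorem ind_indPair (g : G) (h : H) (a : A) (b : B) :
    indProd φ ρ σ (φ (g, h)) (indPair φ ρ σ a b) = indPair φ ρ σ (ρ g a) (σ h b) :=
  ind_mk_one φ (outer ρ σ) (g, h) (a ⊗ₜ b)

theorem indPair_induction {P : IndProd φ ρ σ → Prop} (h0 : P 0)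
    (hadd : ∀ x y, P x → P y → P (x + y))
    (h1 : ∀ h a b, P (indProd φ ρ σ h (indPair φ ρ σ a b))) (z : IndProd φ ρ σ) :
    P z := by
  induction z using ind_induction with
  | h0 => exact h0
  | hadd x y hx hy => exact hadd x y hx hy
  | h1 h t =>
    induction t using TensorProduct.induction_on with
    | zero => rw [map_zero, map_zero]; exact h0
    | add x y hx hy => rw [map_add, map_add]; exact hadd _ _ hx hy
    | tmul a b => exact h1 h a b

/-- The universal property of the induction of an outer tensor product. -/
def pairLift (f : A →ₗ[k] B →ₗ[k] X)
    (hf : ∀ g h a b, f (ρ g a) (σ h b) = τ (φ (g, h)) (f a b)) :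
    IndProd φ ρ σ →ₗ[k] X :=
  indLift φ (outer ρ σ) τ (TensorProduct.lift f) (by
    intro g t
    induction t using TensorProduct.induction_on with
    | zero => simp
    | add x y hx hy => simp only [map_add, hx, hy]
    | tmul a b => rw [outer_tmul, TensorProduct.lift.tmul, TensorProduct.lift.tmul, hf])

variable {f : A →ₗ[k] B →ₗ[k] X}
    (hf : ∀ g h a b, f (ρ g a) (σ h b) = τ (φ (g, h)) (f a b))

theorem pairLift_indPair (a : A) (b : B) :
    pairLift φ ρ σ τ f hf (indPair φ ρ σ a b) = f a b :=
  indLift_one φ (outer ρ σ) τ _ _ (a ⊗ₜ b)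

theorem pairLift_equivariant (h : K) (z : IndProd φ ρ σ) :
    pairLift φ ρ σ τ f hf (indProd φ ρ σ h z) = τ h (pairLift φ ρ σ τ f hf z) :=
  indLift_equivariant ..

end

section Additivity

variable {G H K A A' A'' B : Type*} [Group G] [Group H] [Group K] [AddCommGroup A] [Module k A]
  [AddCommGroup A'] [Module k A'] [AddCommGroup A''] [Module k A'']
  [AddCommGroup B] [Module k B]
  (φ : G × H →* K) (ρ : Representation k G A) (ρ' : Representation k G A')
  (ρ'' : Representation k G A'') (σ : Representation k H B)

/-- Functoriality of the induction product in the first variable. -/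
def mapLeft (f : A →ₗ[k] A') (hf : ∀ g a, f (ρ g a) = ρ' g (f a)) :
    IndProd φ ρ σ →ₗ[k] IndProd φ ρ' σ :=
  pairLift φ ρ σ (indProd φ ρ' σ) (indPair φ ρ' σ ∘ₗ f) (by
    intro g h a b
    simp only [LinearMap.comp_apply]
    rw [ind_indPair, hf])

theorem mapLeft_equivariant (f : A →ₗ[k] A') (hf : ∀ g a, f (ρ g a) = ρ' g (f a)) (h : K)
    (z : IndProd φ ρ σ) :
    mapLeft φ ρ ρ' σ f hf (indProd φ _ _ h z) = indProd φ _ _ h (mapLeft φ ρ ρ' σ f hf z) :=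
  pairLift_equivariant ..

theorem mapLeft_indPair (f : A →ₗ[k] A') (hf : ∀ g a, f (ρ g a) = ρ' g (f a)) (a : A) (b : B) :
    mapLeft φ ρ ρ' σ f hf (indPair φ ρ σ a b) = indPair φ ρ' σ (f a) b :=
  pairLift_indPair ..

theorem mapLeft_mapLeft (f : A →ₗ[k] A') (hf : ∀ g a, f (ρ g a) = ρ' g (f a))
    (f' : A' →ₗ[k] A'') (hf' : ∀ g a, f' (ρ' g a) = ρ'' g (f' a)) (z : IndProd φ ρ σ) :
    mapLeft φ ρ' ρ'' σ f' hf' (mapLeft φ ρ ρ' σ f hf z) =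
      mapLeft φ ρ ρ'' σ (f' ∘ₗ f) (by simp [hf, hf']) z := by
  induction z using indPair_induction with
  | h0 => simp
  | hadd x y hx hy => simp only [map_add, hx, hy]
  | h1 h a b => simp only [mapLeft_equivariant, mapLeft_indPair, LinearMap.comp_apply]

theorem mapLeft_id (z : IndProd φ ρ σ) :
    mapLeft φ ρ ρ σ LinearMap.id (by simp) z = z := by
  induction z using indPair_induction with
  | h0 => simp
  | hadd x y hx hy => simp only [map_add, hx, hy]
  | h1 h a b => simp only [mapLeft_equivariant, mapLeft_indPair, LinearMap.id_apply]

theorem mapLeft_add (f f' : A →ₗ[k] A') (hf : ∀ g a, f (ρ g a) = ρ' g (f a))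
    (hf' : ∀ g a, f' (ρ g a) = ρ' g (f' a)) (z : IndProd φ ρ σ) :
    mapLeft φ ρ ρ' σ (f + f') (by simp [hf, hf']) z
      = mapLeft φ ρ ρ' σ f hf z + mapLeft φ ρ ρ' σ f' hf' z := by
  induction z using indPair_induction with
  | h0 => simp
  | hadd x y hx hy => simp only [map_add, hx, hy]; abel
  | h1 h a b =>
    simp only [mapLeft_equivariant, mapLeft_indPair, LinearMap.add_apply, map_add]

theorem mapLeft_zero (z : IndProd φ ρ σ) :
    mapLeft φ ρ ρ' σ 0 (by simp) z = 0 := by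
  induction z using indPair_induction with
  | h0 => simp
  | hadd x y hx hy => simp only [map_add, hx, hy, add_zero]
  | h1 h a b =>
    simp only [mapLeft_equivariant, mapLeft_indPair, LinearMap.zero_apply, map_zero]

end Additivity

section Assoc

/-- The trilinear map `(a, b, d) ↦ P a (Q b d)`. -/
def bilinComp {A B C D X : Type*} [AddCommGroup A] [Module k A] [AddCommGroup B] [Module k B]
    [AddCommGroup C] [Module k C] [AddCommGroup D] [Module k D] [AddCommGroup X] [Module k X]
    (P : A →ₗ[k] D →ₗ[k] X) (Q : B →ₗ[k] C →ₗ[k] D) : A →ₗ[k] B →ₗ[k] C →ₗ[k] X where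
  toFun a := Q.compr₂ (P a)
  map_add' _ _ := by ext; simp
  map_smul' _ _ := by ext; simp

variable {G₁ G₂ G₃ G₁₂ G₂₃ L L' A B C X : Type*} [Group G₁] [Group G₂] [Group G₃] [Group G₁₂]
  [Group G₂₃] [Group L] [Group L'] [AddCommGroup A] [Module k A] [AddCommGroup B] [Module k B]
  [AddCommGroup C] [Module k C] [AddCommGroup X] [Module k X]
  (φ : G₁ × G₂ →* G₁₂) (φ' : G₁₂ × G₃ →* L) (ψ : G₂ × G₃ →* G₂₃) (ψ' : G₁ × G₂₃ →* L')
  (c : L ≃* L') (hc : ∀ x y z, c (φ' (φ (x, y), z)) = ψ' (x, ψ (y, z)))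
  (ρ : Representation k G₁ A) (σ : Representation k G₂ B) (τ : Representation k G₃ C)

theorem exists_tripleLift (κ : Representation k L X) (t : A →ₗ[k] B →ₗ[k] C →ₗ[k] X)
    (ht : ∀ x y z a b d, t (ρ x a) (σ y b) (τ z d) = κ (φ' (φ (x, y), z)) (t a b d)) :
    ∃ F : IndProd φ' (indProd φ ρ σ) τ →ₗ[k] X,
      (∀ g z, F (indProd φ' _ _ g z) = κ g (F z)) ∧
      ∀ a b d, F (indPair φ' _ τ (indPair φ ρ σ a b) d) = t a b d := by
  let ν : Representation k G₁₂ (C →ₗ[k] X) :=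
    linHom (Representation.trivial k G₁₂ C) (κ.comp (φ'.comp (MonoidHom.inl G₁₂ G₃)))
  have hν : ∀ g f d, ν g f d = κ (φ' (g, 1)) (f d) := by
    intro g f d
    simp [ν, linHom_apply]
  have ht' : ∀ g h a b, t (ρ g a) (σ h b) = ν (φ (g, h)) (t a b) := by
    intro g h a b
    ext d
    rw [hν, ← ht]
    simp
  have key : ∀ g h (x : X), κ (φ' (1, h)) (κ (φ' (g, 1)) x) = κ (φ' (g, h)) x := by
    intro g h x
    rw [← Module.End.mul_apply, ← map_mul, ← map_mul]
    simp
  have key' : ∀ g h (x : X), κ (φ' (g, 1)) (κ (φ' (1, h)) x) = κ (φ' (g, h)) x := by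
    intro g h x
    rw [← Module.End.mul_apply, ← map_mul, ← map_mul]
    simp
  obtain ⟨s, hs1, hs2⟩ : ∃ s : IndProd φ ρ σ →ₗ[k] C →ₗ[k] X,
      (∀ g z, s (indProd φ ρ σ g z) = ν g (s z)) ∧
      ∀ a b, s (indPair φ ρ σ a b) = t a b :=
    ⟨pairLift φ ρ σ ν t ht', pairLift_equivariant φ ρ σ ν ht', pairLift_indPair φ ρ σ ν ht'⟩
  have h1 : ∀ h z d, s z (τ h d) = κ (φ' (1, h)) (s z d) := by
    intro h z d
    induction z using indPair_induction with
    | h0 => simp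
    | hadd x y hx hy => simp only [map_add, LinearMap.add_apply, hx, hy]
    | h1 l a b =>
      rw [hs1, hν, hν, hs2, key, ← key' l h]
      congr 1
      have := ht 1 1 h a b d
      simpa [show ((1 : G₁), (1 : G₂)) = 1 from rfl] using this
  have hs : ∀ g h z d, s (indProd φ ρ σ g z) (τ h d) = κ (φ' (g, h)) (s z d) := by
    intro g h z d
    rw [h1, hs1, hν, key]
  exact ⟨pairLift φ' _ τ κ s hs, pairLift_equivariant φ' _ τ κ hs, fun a b d => by
    rw [pairLift_indPair, hs2]⟩

theorem exists_tripleLift' (κ : Representation k L' X) (t : A →ₗ[k] B →ₗ[k] C →ₗ[k] X)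
    (ht : ∀ x y z a b d, t (ρ x a) (σ y b) (τ z d) = κ (ψ' (x, ψ (y, z))) (t a b d)) :
    ∃ F : IndProd ψ' ρ (indProd ψ σ τ) →ₗ[k] X,
      (∀ g z, F (indProd ψ' _ _ g z) = κ g (F z)) ∧
      ∀ a b d, F (indPair ψ' ρ _ a (indPair ψ σ τ b d)) = t a b d := by
  let ν : Representation k G₂₃ (A →ₗ[k] X) :=
    linHom (Representation.trivial k G₂₃ A) (κ.comp (ψ'.comp (MonoidHom.inr G₁ G₂₃)))
  have hν : ∀ g f a, ν g f a = κ (ψ' (1, g)) (f a) := by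
    intro g f d
    simp [ν, linHom_apply]
  let t' : B →ₗ[k] C →ₗ[k] A →ₗ[k] X :=
    { toFun := fun b => (t.flip b).flip
      map_add' := by intros; ext; simp
      map_smul' := by intros; ext; simp }
  have htt : ∀ a b d, t' b d a = t a b d := fun _ _ _ => rfl
  have ht' : ∀ g h b d, t' (σ g b) (τ h d) = ν (ψ (g, h)) (t' b d) := by
    intro g h b d
    ext a
    rw [hν, htt, htt, ← ht]
    simp
  have key : ∀ g h (x : X), κ (ψ' (1, h)) (κ (ψ' (g, 1)) x) = κ (ψ' (g, h)) x := by
    intro g h x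
    rw [← Module.End.mul_apply, ← map_mul, ← map_mul]
    simp
  have key' : ∀ g h (x : X), κ (ψ' (g, 1)) (κ (ψ' (1, h)) x) = κ (ψ' (g, h)) x := by
    intro g h x
    rw [← Module.End.mul_apply, ← map_mul, ← map_mul]
    simp
  obtain ⟨s, hs1, hs2⟩ : ∃ s : IndProd ψ σ τ →ₗ[k] A →ₗ[k] X,
      (∀ g z, s (indProd ψ σ τ g z) = ν g (s z)) ∧
      ∀ b d, s (indPair ψ σ τ b d) = t' b d :=
    ⟨pairLift ψ σ τ ν t' ht', pairLift_equivariant ψ σ τ ν ht', pairLift_indPair ψ σ τ ν ht'⟩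
  have h1 : ∀ g z a, s z (ρ g a) = κ (ψ' (g, 1)) (s z a) := by
    intro g z a
    induction z using indPair_induction with
    | h0 => simp
    | hadd x y hx hy => simp only [map_add, LinearMap.add_apply, hx, hy]
    | h1 l b d =>
      rw [hs1, hν, hν, hs2, key', ← key g l, htt, htt]
      congr 1
      have := ht g 1 1 a b d
      simpa [show ((1 : G₂), (1 : G₃)) = 1 from rfl] using this
  have hs : ∀ g h a z, s.flip (ρ g a) (indProd ψ σ τ h z) = κ (ψ' (g, h)) (s.flip a z) := by
    intro g h a z
    rw [LinearMap.flip_apply, LinearMap.flip_apply, h1, hs1, hν, key']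
  exact ⟨pairLift ψ' ρ _ κ s.flip hs, pairLift_equivariant ψ' ρ _ κ hs, fun a b d => by
    rw [pairLift_indPair, LinearMap.flip_apply, hs2, htt]⟩

theorem triple_induction {P : IndProd φ' (indProd φ ρ σ) τ → Prop} (h0 : P 0)
    (hadd : ∀ x y, P x → P y → P (x + y))
    (h1 : ∀ h a b d, P (indProd φ' _ _ h (indPair φ' _ τ (indPair φ ρ σ a b) d)))
    (z : IndProd φ' (indProd φ ρ σ) τ) : P z := by
  induction z using indPair_induction with
  | h0 => exact h0
  | hadd x y hx hy => exact hadd x y hx hy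
  | h1 h w d =>
    induction w using indPair_induction with
    | h0 => simpa using h0
    | hadd x y hx hy => simpa only [map_add, LinearMap.add_apply] using hadd _ _ hx hy
    | h1 l a b =>
      have := h1 (h * φ' (l, 1)) a b d
      rw [map_mul, Module.End.mul_apply, ind_indPair] at this
      simpa using this

theorem triple_induction' {P : IndProd ψ' ρ (indProd ψ σ τ) → Prop} (h0 : P 0)
    (hadd : ∀ x y, P x → P y → P (x + y))
    (h1 : ∀ h a b d, P (indProd ψ' _ _ h (indPair ψ' ρ _ a (indPair ψ σ τ b d))))
    (z : IndProd ψ' ρ (indProd ψ σ τ)) : P z := by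
  induction z using indPair_induction with
  | h0 => exact h0
  | hadd x y hx hy => exact hadd x y hx hy
  | h1 h a w =>
    induction w using indPair_induction with
    | h0 => simpa using h0
    | hadd x y hx hy => simpa only [map_add, LinearMap.add_apply] using hadd _ _ hx hy
    | h1 l b d =>
      have := h1 (h * ψ' (1, l)) a b d
      rw [map_mul, Module.End.mul_apply, ind_indPair] at this
      simpa using this

/-- A trilinear form of the universal bilinear maps, bracketed to the left. -/
def triL : A →ₗ[k] B →ₗ[k] C →ₗ[k] IndProd φ' (indProd φ ρ σ) τ :=
  (indPair φ ρ σ).compr₂ (indPair φ' _ τ)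

/-- A trilinear form of the universal bilinear maps, bracketed to the right. -/
def triR : A →ₗ[k] B →ₗ[k] C →ₗ[k] IndProd ψ' ρ (indProd ψ σ τ) :=
  bilinComp (indPair ψ' ρ _) (indPair ψ σ τ)

theorem triL_apply (a : A) (b : B) (d : C) :
    triL φ φ' ρ σ τ a b d = indPair φ' _ τ (indPair φ ρ σ a b) d := rfl

theorem triR_apply (a : A) (b : B) (d : C) :
    triR ψ ψ' ρ σ τ a b d = indPair ψ' ρ _ a (indPair ψ σ τ b d) := rfl

theorem exists_assocEquiv (hc : ∀ x y z, c (φ' (φ (x, y), z)) = ψ' (x, ψ (y, z))) :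
    ∃ e : IndProd φ' (indProd φ ρ σ) τ ≃ₗ[k] IndProd ψ' ρ (indProd ψ σ τ),
      ∀ g z, e (indProd φ' _ _ g z) = indProd ψ' _ _ (c g) (e z) := by
  let κ : Representation k L (IndProd ψ' ρ (indProd ψ σ τ)) :=
    (indProd ψ' ρ (indProd ψ σ τ)).comp c.toMonoidHom
  have hκ : ∀ g z, κ g z = indProd ψ' ρ (indProd ψ σ τ) (c g) z := fun _ _ => rfl
  let κ' : Representation k L' (IndProd φ' (indProd φ ρ σ) τ) :=
    (indProd φ' (indProd φ ρ σ) τ).comp c.symm.toMonoidHom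
  have hκ' : ∀ g z, κ' g z = indProd φ' (indProd φ ρ σ) τ (c.symm g) z :=
    fun _ _ => rfl
  have hR : ∀ x y z a b d, triR ψ ψ' ρ σ τ (ρ x a) (σ y b) (τ z d)
      = κ (φ' (φ (x, y), z)) (triR ψ ψ' ρ σ τ a b d) := by
    intro x y z a b d
    rw [hκ, hc, triR_apply, triR_apply, ind_indPair, ind_indPair]
  have hL : ∀ x y z a b d, triL φ φ' ρ σ τ (ρ x a) (σ y b) (τ z d)
      = κ' (ψ' (x, ψ (y, z))) (triL φ φ' ρ σ τ a b d) := by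
    intro x y z a b d
    rw [hκ', ← hc, MulEquiv.symm_apply_apply, triL_apply, triL_apply, ind_indPair, ind_indPair]
  obtain ⟨F, hF, hF'⟩ := exists_tripleLift φ φ' ρ σ τ κ (triR ψ ψ' ρ σ τ) hR
  obtain ⟨F', hG, hG'⟩ := exists_tripleLift' ψ ψ' ρ σ τ κ' (triL φ φ' ρ σ τ) hL
  have hF2 : ∀ g z, F (indProd φ' _ _ g z) = indProd ψ' _ _ (c g) (F z) := hF
  have hG2 : ∀ g z, F' (indProd ψ' _ _ g z) = indProd φ' _ _ (c.symm g) (F' z) := hG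
  refine ⟨LinearEquiv.ofLinearMap F F' ?_ ?_, hF2⟩
  · refine LinearMap.ext fun z => ?_
    induction z using triple_induction' with
    | h0 => simp
    | hadd x y hx hy => simp only [map_add, hx, hy]
    | h1 h a b d =>
      rw [LinearMap.comp_apply, hG2, hG', triL_apply, hF2, hF', triR_apply]
      simp
  · refine LinearMap.ext fun z => ?_
    induction z using triple_induction with
    | h0 => simp
    | hadd x y hx hy => simp only [map_add, hx, hy]
    | h1 h a b d =>
      rw [LinearMap.comp_apply, hF2, hF', triR_apply, hG2, hG', triL_apply]
      simp

end Assoc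

section CommUnit

variable {G₁ G₂ L L' A B : Type*} [Group G₁] [Group G₂] [Group L] [Group L']
  [AddCommGroup A] [Module k A] [AddCommGroup B] [Module k B]
  (φ : G₁ × G₂ →* L) (ψ : G₂ × G₁ →* L') (c : L ≃* L') (w : L')
  (ρ : Representation k G₁ A) (σ : Representation k G₂ B)

theorem exists_commEquiv (hc : ∀ x y, c (φ (x, y)) * w = w * ψ (y, x)) :
    ∃ e : IndProd φ ρ σ ≃ₗ[k] IndProd ψ σ ρ,
      ∀ g z, e (indProd φ _ _ g z) = indProd ψ _ _ (c g) (e z) := by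
  let κ : Representation k L (IndProd ψ σ ρ) := (indProd ψ σ ρ).comp c.toMonoidHom
  let κ' : Representation k L' (IndProd φ ρ σ) := (indProd φ ρ σ).comp c.symm.toMonoidHom
  have hκ : ∀ g z, κ g z = indProd ψ σ ρ (c g) z := fun _ _ => rfl
  have hκ' : ∀ g z, κ' g z = indProd φ ρ σ (c.symm g) z := fun _ _ => rfl
  let f : A →ₗ[k] B →ₗ[k] IndProd ψ σ ρ :=
    (indPair ψ σ ρ).flip.compr₂ (indProd ψ σ ρ w)
  have f_apply : ∀ a b, f a b = indProd ψ σ ρ w (indPair ψ σ ρ b a) := fun _ _ => rfl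
  let f' : B →ₗ[k] A →ₗ[k] IndProd φ ρ σ :=
    (indPair φ ρ σ).flip.compr₂ (indProd φ ρ σ (c.symm w⁻¹))
  have f'_apply : ∀ a b, f' b a = indProd φ ρ σ (c.symm w⁻¹) (indPair φ ρ σ a b) :=
    fun _ _ => rfl
  have hf : ∀ x y a b, f (ρ x a) (σ y b) = κ (φ (x, y)) (f a b) := by
    intro x y a b
    rw [f_apply, f_apply, hκ, ← ind_indPair, ← Module.End.mul_apply, ← Module.End.mul_apply,
      ← map_mul, ← map_mul, hc]
  have hc' : ∀ x y, c.symm w⁻¹ * φ (x, y) = c.symm (ψ (y, x)) * c.symm w⁻¹ := by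
    intro x y
    apply c.injective
    rw [map_mul, map_mul, c.apply_symm_apply, c.apply_symm_apply, eq_mul_inv_iff_mul_eq,
      mul_assoc, hc, inv_mul_cancel_left]
  have hf' : ∀ y x b a, f' (σ y b) (ρ x a) = κ' (ψ (y, x)) (f' b a) := by
    intro y x b a
    rw [f'_apply, f'_apply, hκ', ← ind_indPair, ← Module.End.mul_apply, ← Module.End.mul_apply,
      ← map_mul, ← map_mul, hc']
  obtain ⟨F, hF, hF'⟩ : ∃ F : IndProd φ ρ σ →ₗ[k] IndProd ψ σ ρ,
      (∀ g z, F (indProd φ _ _ g z) = indProd ψ _ _ (c g) (F z)) ∧ ∀ a b, F (indPair φ ρ σ a b) = f a b :=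
    ⟨pairLift φ ρ σ κ f hf, pairLift_equivariant φ ρ σ κ hf, pairLift_indPair φ ρ σ κ hf⟩
  obtain ⟨F', hG, hG'⟩ : ∃ F' : IndProd ψ σ ρ →ₗ[k] IndProd φ ρ σ,
      (∀ g z, F' (indProd ψ _ _ g z) = indProd φ _ _ (c.symm g) (F' z)) ∧
        ∀ b a, F' (indPair ψ σ ρ b a) = f' b a :=
    ⟨pairLift ψ σ ρ κ' f' hf', pairLift_equivariant ψ σ ρ κ' hf', pairLift_indPair ψ σ ρ κ' hf'⟩
  refine ⟨LinearEquiv.ofLinearMap F F' ?_ ?_, hF⟩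
  · refine LinearMap.ext fun z => ?_
    induction z using indPair_induction with
    | h0 => simp
    | hadd x y hx hy => simp only [map_add, hx, hy]
    | h1 h b a =>
      rw [LinearMap.comp_apply, hG, hG', f'_apply, hF, hF, hF', f_apply, c.apply_symm_apply,
        c.apply_symm_apply, ← Module.End.mul_apply (indProd ψ _ _ w⁻¹), ← map_mul]
      simp
  · refine LinearMap.ext fun z => ?_
    induction z using indPair_induction with
    | h0 => simp
    | hadd x y hx hy => simp only [map_add, hx, hy]
    | h1 h a b =>
      rw [LinearMap.comp_apply, hF, hF', f_apply, hG, hG, hG', f'_apply, c.symm_apply_apply,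
        ← Module.End.mul_apply (indProd φ _ _ (c.symm w)), ← map_mul, ← map_mul]
      simp

/-- Inducing along an isomorphism does nothing; here the second factor is the trivial
representation of a trivial group. -/
theorem exists_unitEquiv [Subsingleton G₂] (φ : G₁ × G₂ →* L) (c : L ≃* G₁)
    (hc : ∀ x y, c (φ (x, y)) = x) :
    ∃ e : IndProd φ ρ (Representation.trivial k G₂ k) ≃ₗ[k] A,
      ∀ g z, e (indProd φ _ _ g z) = ρ (c g) (e z) := by
  let σ := Representation.trivial k G₂ k
  have hφ : ∀ l, φ (c l, 1) = l := fun l => c.injective (hc _ _)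
  let f : A →ₗ[k] k →ₗ[k] A := (LinearMap.lsmul k A).flip
  have f_apply : ∀ a r, f a r = r • a := fun _ _ => rfl
  let κ : Representation k L A := ρ.comp c.toMonoidHom
  have hκ : ∀ g z, κ g z = ρ (c g) z := fun _ _ => rfl
  have hf : ∀ x y a r, f (ρ x a) (σ y r) = κ (φ (x, y)) (f a r) := by
    intro x y a r
    rw [f_apply, f_apply, hκ, hc]
    simp [σ]
  obtain ⟨F, hF, hF'⟩ : ∃ F : IndProd φ ρ σ →ₗ[k] A,
      (∀ g z, F (indProd φ _ _ g z) = ρ (c g) (F z)) ∧ ∀ a b, F (indPair φ ρ σ a b) = f a b :=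
    ⟨pairLift φ ρ σ κ f hf, pairLift_equivariant φ ρ σ κ hf, pairLift_indPair φ ρ σ κ hf⟩
  refine ⟨LinearEquiv.ofLinearMap F ((indPair φ ρ σ).flip 1) ?_ ?_, hF⟩
  · ext a
    simp [hF', f_apply]
  · refine LinearMap.ext fun z => ?_
    induction z using indPair_induction with
    | h0 => simp
    | hadd x y hx hy => simp only [map_add, hx, hy]
    | h1 h a r =>
      rw [LinearMap.comp_apply, hF, hF', f_apply, LinearMap.flip_apply]
      nth_rw 2 [← hφ h]
      rw [ind_indPair]
      rw [map_smul, map_smul, LinearMap.smul_apply, ← map_smul]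
      simp [σ]

end CommUnit
end Product

section GrothendieckGroup

/-- The relations `[B] = [A] + [C]` for the short exact sequences `0 → A → B → C → 0` of
finite-dimensional representations of `G` over `k`. -/
def exactRelations (k : Type u) [Field k] (G : Type*) [Group G] :
    Set (FreeAbelianGroup (FDRep k G)) :=
  {x | ∃ (A B C : FDRep k G) (i : IntertwiningMap A.ρ B.ρ) (p : IntertwiningMap B.ρ C.ρ),
    Function.Injective i ∧ Function.Exact i p ∧ Function.Surjective p ∧
      x = FreeAbelianGroup.of B - FreeAbelianGroup.of A - FreeAbelianGroup.of C}

/-- The Grothendieck group `K₀` of the abelian category of finite-dimensional representations of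
`G` over `k`. -/
def RepK0 (k : Type u) [Field k] (G : Type*) [Group G] : Type _ :=
  FreeAbelianGroup (FDRep k G) ⧸ AddSubgroup.closure (exactRelations k G)

variable {k : Type u} [Field k]

section

variable {G : Type*} [Group G]

instance : AddCommGroup (RepK0 k G) :=
  inferInstanceAs (AddCommGroup (_ ⧸ AddSubgroup.closure (exactRelations k G)))

/-- The quotient map from the free abelian group on the objects. -/
def RepK0.proj : FreeAbelianGroup (FDRep k G) →+ RepK0 k G :=
  QuotientAddGroup.mk' (AddSubgroup.closure (exactRelations k G))

/-- The class `[V]` in the Grothendieck group. -/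
def RepK0.mk (V : FDRep k G) : RepK0 k G :=
  RepK0.proj (FreeAbelianGroup.of V)

theorem RepK0.mk_eq_add {A B C : FDRep k G} (i : IntertwiningMap A.ρ B.ρ)
    (p : IntertwiningMap B.ρ C.ρ) (hi : Function.Injective i) (hip : Function.Exact i p)
    (hp : Function.Surjective p) : RepK0.mk B = RepK0.mk A + RepK0.mk C := by
  rw [← sub_eq_zero, ← sub_sub]
  unfold RepK0.mk
  rw [← map_sub, ← map_sub]
  exact (QuotientAddGroup.eq_zero_iff _).2
    (AddSubgroup.subset_closure ⟨A, B, C, i, p, hi, hip, hp, rfl⟩)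

@[elab_as_elim]
theorem RepK0.induction {P : RepK0 k G → Prop} (h0 : P 0) (hmk : ∀ V, P (RepK0.mk V))
    (hneg : ∀ x, P x → P (-x)) (hadd : ∀ x y, P x → P y → P (x + y)) (x : RepK0 k G) : P x := by
  obtain ⟨x, rfl⟩ := QuotientAddGroup.mk'_surjective _ x
  induction x using FreeAbelianGroup.induction_on with
  | zero => exact h0
  | of V => exact hmk V
  | neg V hV => rw [map_neg]; exact hneg _ hV
  | add x y hx hy => rw [map_add]; exact hadd _ _ hx hy

/-- The universal property of the Grothendieck group. -/
def RepK0.lift {M : Type*} [AddCommGroup M] (f : FDRep k G → M)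
    (hf : ∀ (A B C : FDRep k G) (i : IntertwiningMap A.ρ B.ρ) (p : IntertwiningMap B.ρ C.ρ),
      Function.Injective i → Function.Exact i p → Function.Surjective p → f B = f A + f C) :
    RepK0 k G →+ M :=
  QuotientAddGroup.lift _ (FreeAbelianGroup.lift f) (by
    rw [AddSubgroup.closure_le]
    rintro _ ⟨A, B, C, i, p, hi, hip, hp, rfl⟩
    simp [hf A B C i p hi hip hp])

theorem RepK0.lift_mk {M : Type*} [AddCommGroup M] (f : FDRep k G → M)
    (hf : ∀ (A B C : FDRep k G) (i : IntertwiningMap A.ρ B.ρ) (p : IntertwiningMap B.ρ C.ρ),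
      Function.Injective i → Function.Exact i p → Function.Surjective p → f B = f A + f C)
    (V : FDRep k G) : RepK0.lift f hf (RepK0.mk V) = f V :=
  FreeAbelianGroup.lift_apply_of f V

theorem RepK0.mk_eq_of_equiv {V W : FDRep k G} (e : V ≃ₗ[k] W)
    (he : ∀ g v, e (V.ρ g v) = W.ρ g (e v)) : RepK0.mk V = RepK0.mk W := by
  let Z : FDRep k G := FDRep.of (Representation.trivial k G PUnit.{u + 1})
  have hz : RepK0.mk Z = 0 := by
    have := RepK0.mk_eq_add (A := Z) (B := Z) (C := Z) 0 0 (fun _ _ _ => rfl)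
      (fun x => ⟨fun _ => ⟨x, rfl⟩, fun _ => rfl⟩) (fun x => ⟨x, rfl⟩)
    simpa using this
  have := RepK0.mk_eq_add (A := V) (B := W) (C := Z)
    ⟨e.toLinearMap, fun g => LinearMap.ext fun v => he g v⟩ 0 e.injective
      (fun x => ⟨fun _ => ⟨e.symm x, e.apply_symm_apply x⟩, fun _ => rfl⟩) (fun x => ⟨0, rfl⟩)
  rw [this, hz, add_zero]

/-- Maschke's theorem: short exact sequences split. -/
theorem exists_splitting [CharZero k] [Finite G] {A B C : FDRep k G}
    (i : IntertwiningMap A.ρ B.ρ) (p : IntertwiningMap B.ρ C.ρ) (hi : Function.Injective i)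
    (hip : Function.Exact i p) (hp : Function.Surjective p) :
    ∃ (r : B →ₗ[k] A) (s : C →ₗ[k] B), (∀ g b, r (B.ρ g b) = A.ρ g (r b)) ∧
      (∀ g c, s (C.ρ g c) = B.ρ g (s c)) ∧ (∀ a, r (i a) = a) ∧ (∀ c, p (s c) = c) ∧
      ∀ b, i (r b) + s (p b) = b := by
  have : NeZero (Nat.card G : k) := ⟨Nat.cast_ne_zero.2 Nat.card_pos.ne'⟩
  obtain ⟨r', hr'⟩ := MonoidAlgebra.exists_leftInverse_of_injective
    (IntertwiningMap.equivLinearMapAsModule A.ρ B.ρ i) (LinearMap.ker_eq_bot.2 hi)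
  obtain ⟨r, rfl⟩ := (IntertwiningMap.equivLinearMapAsModule B.ρ A.ρ).surjective r'
  have hri : ∀ a, r (i a) = a := fun a => LinearMap.congr_fun hr' a
  have hrg : ∀ g b, r (B.ρ g b) = A.ρ g (r b) := fun g b => LinearMap.congr_fun (r.2 g) b
  have hig : ∀ g b, i (A.ρ g b) = B.ρ g (i b) := fun g b => LinearMap.congr_fun (i.2 g) b
  have hpg : ∀ g b, p (B.ρ g b) = C.ρ g (p b) := fun g b => LinearMap.congr_fun (p.2 g) b
  obtain ⟨t, ht⟩ := p.toLinearMap.exists_rightInverse_of_surjective (LinearMap.range_eq_top.2 hp)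
  have htp : ∀ c, p (t c) = c := fun c => LinearMap.congr_fun ht c
  have hpi : ∀ a, p (i a) = 0 := fun a => (hip (i a)).2 ⟨a, rfl⟩
  have key : ∀ b, p b = 0 → i (r b) = b := by
    intro b hb
    obtain ⟨a, rfl⟩ := (hip b).1 hb
    rw [hri]
  have hs : ∀ c, (t - i.toLinearMap ∘ₗ r.toLinearMap ∘ₗ t) c = t c - i (r (t c)) := fun _ => rfl
  refine ⟨r.toLinearMap, t - i.toLinearMap ∘ₗ r.toLinearMap ∘ₗ t, hrg, ?_, hri, ?_, ?_⟩
  · intro g c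
    have := key (t (C.ρ g c) - B.ρ g (t c)) (by rw [map_sub, hpg, htp, htp, sub_self])
    rw [map_sub, map_sub, hrg, hig] at this
    rw [hs, hs, map_sub]
    rw [sub_eq_sub_iff_sub_eq_sub, ← this]
  · intro c
    rw [hs, map_sub, htp, hpi, sub_zero]
  · intro b
    have := key (b - t (p b)) (by rw [map_sub, htp, sub_self])
    rw [map_sub, map_sub] at this
    rw [hs]
    change i (r b) + _ = b
    have h2 : i (r b) = b - t (p b) + i (r (t (p b))) := by rw [← this]; abel
    rw [h2]; abel

end

end GrothendieckGroup

section Ring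

/-- The embedding `S_m × S_n → S_{m+n}` as a Young subgroup: the first factor permutes the first
`m` points, the second one permutes the last `n` points. -/
def youngHom (m n : ℕ) : Equiv.Perm (Fin m) × Equiv.Perm (Fin n) →* Equiv.Perm (Fin (m + n)) :=
  (finSumFinEquiv.permCongrHom : Equiv.Perm (Fin m ⊕ Fin n) ≃* _).toMonoidHom.comp
    (Equiv.Perm.sumCongrHom (Fin m) (Fin n))

theorem youngHom_castAdd {m n : ℕ} (g : Equiv.Perm (Fin m)) (h : Equiv.Perm (Fin n)) (i : Fin m) :
    youngHom m n (g, h) (Fin.castAdd n i) = Fin.castAdd n (g i) := by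
  simp [youngHom]

theorem youngHom_natAdd {m n : ℕ} (g : Equiv.Perm (Fin m)) (h : Equiv.Perm (Fin n)) (i : Fin n) :
    youngHom m n (g, h) (Fin.natAdd m i) = Fin.natAdd m (h i) := by
  simp [youngHom]

/-- Transport of permutations along an equality `m = n`. -/
def permCast {m n : ℕ} (h : m = n) : Equiv.Perm (Fin m) ≃* Equiv.Perm (Fin n) :=
  (finCongr h).permCongrHom

theorem permCast_cast {m n : ℕ} (h : m = n) (g : Equiv.Perm (Fin m)) (i : Fin m) :
    permCast h g (Fin.cast h i) = Fin.cast h (g i) := by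
  subst h; rfl

theorem permCast_assoc {m n p : ℕ} (x : Equiv.Perm (Fin m)) (y : Equiv.Perm (Fin n))
    (z : Equiv.Perm (Fin p)) :
    permCast (Nat.add_assoc m n p) (youngHom (m + n) p (youngHom m n (x, y), z)) =
      youngHom m (n + p) (x, youngHom n p (y, z)) := by
  refine Equiv.ext fun j => ?_
  obtain ⟨j, rfl⟩ := (finCongr (Nat.add_assoc m n p)).surjective j
  rw [finCongr_apply, permCast_cast]
  induction j using Fin.addCases with
  | left j =>
    induction j using Fin.addCases with
    | left j =>
      rw [youngHom_castAdd, youngHom_castAdd]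
      exact (youngHom_castAdd x (youngHom n p (y, z)) j).symm
    | right j =>
      rw [youngHom_castAdd, youngHom_natAdd]
      have h1 : ∀ j : Fin n, Fin.cast (Nat.add_assoc m n p) (Fin.castAdd p (Fin.natAdd m j)) =
        Fin.natAdd m (Fin.castAdd p j) := fun _ => rfl
      rw [h1, h1, youngHom_natAdd, youngHom_castAdd]
  | right j =>
    rw [youngHom_natAdd]
    have h1 : ∀ j : Fin p, Fin.cast (Nat.add_assoc m n p) (Fin.natAdd (m + n) j) =
      Fin.natAdd m (Fin.natAdd n j) := fun j => Fin.ext (Nat.add_assoc m n j)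
    rw [h1, h1, youngHom_natAdd, youngHom_natAdd]

/-- The permutation that exchanges the blocks `n` and `m`. -/
def blockSwap (m n : ℕ) : Equiv.Perm (Fin (n + m)) :=
  finAddFlip.trans (finCongr (Nat.add_comm m n))

theorem permCast_comm {m n : ℕ} (x : Equiv.Perm (Fin m)) (y : Equiv.Perm (Fin n)) :
    permCast (Nat.add_comm m n) (youngHom m n (x, y)) * blockSwap m n =
      blockSwap m n * youngHom n m (y, x) := by
  have h1 : ∀ j : Fin n, blockSwap m n (Fin.castAdd m j) =
      Fin.cast (Nat.add_comm m n) (Fin.natAdd m j) := fun j => by simp [blockSwap]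
  have h2 : ∀ j : Fin m, blockSwap m n (Fin.natAdd n j) =
      Fin.cast (Nat.add_comm m n) (Fin.castAdd n j) := fun j => by simp [blockSwap]
  refine Equiv.ext fun j => ?_
  rw [Equiv.Perm.mul_apply, Equiv.Perm.mul_apply]
  induction j using Fin.addCases with
  | left j => rw [h1, permCast_cast, youngHom_natAdd, youngHom_castAdd, h1]
  | right j => rw [h2, permCast_cast, youngHom_castAdd, youngHom_natAdd, h2]

variable (k : Type u) [Field k]

/-- The degree `n` part of `K₀(𝒯_k)`, the Grothendieck group of `k[S_n]-mod`. -/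
abbrev K0Deg (n : ℕ) : Type (u + 1) := RepK0 k (Equiv.Perm (Fin n))

variable {k}

/-- The tensor product of `V ∈ k[S_m]-mod` and `W ∈ k[S_n]-mod` in the category `𝒯_k`: the
representation of `S_{m+n}` induced from the representation `V ⊗ W` of `S_m × S_n`. -/
def tensorObj {m n : ℕ} (V : FDRep k (Equiv.Perm (Fin m))) (W : FDRep k (Equiv.Perm (Fin n))) :
    FDRep k (Equiv.Perm (Fin (m + n))) :=
  FDRep.of (indProd (youngHom m n) V.ρ W.ρ)

/-- Transport along an equality of degrees. -/
def castHom {m n : ℕ} (h : m = n) : K0Deg k m →+ K0Deg k n :=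
  h ▸ AddMonoidHom.id _

theorem mk_castHom {m n : ℕ} (h : m = n) (a : K0Deg k m) :
    GradedMonoid.mk (A := K0Deg k) m a = GradedMonoid.mk n (castHom h a) := by
  subst h; rfl

theorem castHom_mk {m n : ℕ} (h : m = n) {V : FDRep k (Equiv.Perm (Fin m))}
    {W : FDRep k (Equiv.Perm (Fin n))}
    (H : ∃ e : V ≃ₗ[k] W, ∀ g v, e (V.ρ g v) = W.ρ (permCast h g) (e v)) :
    castHom h (RepK0.mk V) = RepK0.mk W := by
  obtain ⟨e, he⟩ := H
  subst h
  exact RepK0.mk_eq_of_equiv e he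

theorem castHom_symm {m n : ℕ} (h : m = n) {a : K0Deg k m} {b : K0Deg k n}
    (hab : castHom h a = b) : a = castHom h.symm b := by
  subst h; exact hab

theorem castHom_tensorObj_comm {m n : ℕ} (V : FDRep k (Equiv.Perm (Fin m)))
    (W : FDRep k (Equiv.Perm (Fin n))) :
    castHom (Nat.add_comm m n) (RepK0.mk (tensorObj V W)) = RepK0.mk (tensorObj W V) :=
  castHom_mk _ (exists_commEquiv (youngHom m n) (youngHom n m) (permCast (Nat.add_comm m n))
    (blockSwap m n) V.ρ W.ρ permCast_comm)

theorem castHom_tensorObj_assoc {m n p : ℕ} (U : FDRep k (Equiv.Perm (Fin m)))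
    (V : FDRep k (Equiv.Perm (Fin n))) (W : FDRep k (Equiv.Perm (Fin p))) :
    castHom (Nat.add_assoc m n p) (RepK0.mk (tensorObj (tensorObj U V) W)) =
      RepK0.mk (tensorObj U (tensorObj V W)) :=
  castHom_mk _ (exists_assocEquiv (youngHom m n) (youngHom (m + n) p) (youngHom n p)
    (youngHom m (n + p)) (permCast (Nat.add_assoc m n p)) U.ρ V.ρ W.ρ permCast_assoc)

/-- The unit object of `𝒯_k`, the trivial representation of `S_0`. -/
def unitObj (k : Type u) [Field k] : FDRep k (Equiv.Perm (Fin 0)) :=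
  FDRep.of (Representation.trivial k (Equiv.Perm (Fin 0)) k)

theorem mk_tensorObj_unit {n : ℕ} (V : FDRep k (Equiv.Perm (Fin n))) :
    RepK0.mk (tensorObj V (unitObj k)) = RepK0.mk V := by
  obtain ⟨e, he⟩ := exists_unitEquiv V.ρ (youngHom n 0) (MulEquiv.refl _) (by
    intro x y
    exact Equiv.ext fun j => youngHom_castAdd x y j)
  exact RepK0.mk_eq_of_equiv e he

variable [CharZero k]

theorem mk_tensorObj_left {m n : ℕ} {A B C : FDRep k (Equiv.Perm (Fin m))}
    (W : FDRep k (Equiv.Perm (Fin n)))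
    (i : IntertwiningMap A.ρ B.ρ) (p : IntertwiningMap B.ρ C.ρ) (hi : Function.Injective i)
    (hip : Function.Exact i p) (hp : Function.Surjective p) :
    RepK0.mk (tensorObj B W) = RepK0.mk (tensorObj A W) + RepK0.mk (tensorObj C W) := by
  obtain ⟨r, s, hr, hs, hri, hps, hrs⟩ := exists_splitting i p hi hip hp
  have hig : ∀ g b, i.toLinearMap (A.ρ g b) = B.ρ g (i.toLinearMap b) :=
    fun g b => LinearMap.congr_fun (i.2 g) b
  have hpg : ∀ g b, p.toLinearMap (B.ρ g b) = C.ρ g (p.toLinearMap b) :=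
    fun g b => LinearMap.congr_fun (p.2 g) b
  let φ := youngHom m n
  let I := mapLeft φ A.ρ B.ρ W.ρ i.toLinearMap hig
  let P := mapLeft φ B.ρ C.ρ W.ρ p.toLinearMap hpg
  let R := mapLeft φ B.ρ A.ρ W.ρ r hr
  let S := mapLeft φ C.ρ B.ρ W.ρ s hs
  have hRI : ∀ z, R (I z) = z := by
    intro z
    simp only [R, I, mapLeft_mapLeft]
    convert mapLeft_id φ A.ρ W.ρ z using 2
    congr 1
    exact LinearMap.ext hri
  have hPS : ∀ z, P (S z) = z := by
    intro z
    simp only [P, S, mapLeft_mapLeft]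
    convert mapLeft_id φ C.ρ W.ρ z using 2
    congr 1
    exact LinearMap.ext hps
  have hPI : ∀ z, P (I z) = 0 := by
    intro z
    simp only [P, I, mapLeft_mapLeft]
    convert mapLeft_zero φ A.ρ C.ρ W.ρ z using 2
    congr 1
    exact LinearMap.ext fun a => (hip (i a)).2 ⟨a, rfl⟩
  have hsum : ∀ z, I (R z) + S (P z) = z := by
    intro z
    simp only [P, S, I, R, mapLeft_mapLeft]
    rw [← mapLeft_add]
    convert mapLeft_id φ B.ρ W.ρ z using 2
    congr 1
    exact LinearMap.ext hrs
  refine RepK0.mk_eq_add (A := tensorObj A W) (B := tensorObj B W) (C := tensorObj C W)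
    ⟨I, fun g => LinearMap.ext fun z => mapLeft_equivariant ..⟩
    ⟨P, fun g => LinearMap.ext fun z => mapLeft_equivariant ..⟩
    (Function.LeftInverse.injective hRI) ?_ (Function.RightInverse.surjective hPS)
  intro z
  constructor
  · intro hz
    refine ⟨R z, ?_⟩
    have h := hsum z
    rw [show P z = 0 from hz, map_zero, add_zero] at h
    exact h
  · rintro ⟨y, rfl⟩
    exact hPI y

/-- The multiplication `K₀(k[S_m]-mod) × K₀(k[S_n]-mod) → K₀(k[S_{m+n}]-mod)` induced by the
tensor product of `𝒯_k`. -/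
def mulHom (m n : ℕ) : K0Deg k m →+ K0Deg k n →+ K0Deg k (m + n) :=
  RepK0.lift
    (fun V => RepK0.lift (fun W => RepK0.mk (tensorObj V W)) (by
      intro A B C i p hi hip hp
      simp only [castHom_symm _ (castHom_tensorObj_comm V _)]
      rw [mk_tensorObj_left V i p hi hip hp, map_add]))
    (by
      intro A B C i p hi hip hp
      ext x
      induction x using RepK0.induction with
      | h0 => simp
      | hneg x hx => simp only [map_neg, hx]
      | hadd x y hx hy => simp only [map_add, hx, hy]
      | hmk W =>
        simp only [AddMonoidHom.add_apply, RepK0.lift_mk]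
        exact mk_tensorObj_left W i p hi hip hp)

theorem mulHom_mk {m n : ℕ} (V : FDRep k (Equiv.Perm (Fin m))) (W : FDRep k (Equiv.Perm (Fin n))) :
    mulHom m n (RepK0.mk V) (RepK0.mk W) = RepK0.mk (tensorObj V W) := by
  simp only [mulHom, RepK0.lift_mk]

theorem mulHom_assoc {m n p : ℕ} (a : K0Deg k m) (b : K0Deg k n) (c : K0Deg k p) :
    castHom (Nat.add_assoc m n p) (mulHom (m + n) p (mulHom m n a b) c) =
      mulHom m (n + p) a (mulHom n p b c) := by
  induction a using RepK0.induction with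
  | h0 => simp
  | hneg x hx => simp only [map_neg, AddMonoidHom.neg_apply, hx]
  | hadd x y hx hy => simp only [map_add, AddMonoidHom.add_apply, hx, hy]
  | hmk U =>
    induction b using RepK0.induction with
    | h0 => simp
    | hneg x hx => simp only [map_neg, AddMonoidHom.neg_apply, hx]
    | hadd x y hx hy => simp only [map_add, AddMonoidHom.add_apply, hx, hy]
    | hmk V =>
      induction c using RepK0.induction with
      | h0 => simp
      | hneg x hx => simp only [map_neg, hx]
      | hadd x y hx hy => simp only [map_add, hx, hy]
      | hmk W => simp only [mulHom_mk, castHom_tensorObj_assoc]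

theorem mulHom_comm {m n : ℕ} (a : K0Deg k m) (b : K0Deg k n) :
    castHom (Nat.add_comm m n) (mulHom m n a b) = mulHom n m b a := by
  induction a using RepK0.induction with
  | h0 => simp
  | hneg x hx => simp only [map_neg, AddMonoidHom.neg_apply, hx]
  | hadd x y hx hy => simp only [map_add, AddMonoidHom.add_apply, hx, hy]
  | hmk V =>
    induction b using RepK0.induction with
    | h0 => simp
    | hneg x hx => simp only [map_neg, AddMonoidHom.neg_apply, hx]
    | hadd x y hx hy => simp only [map_add, AddMonoidHom.add_apply, hx, hy]
    | hmk W => simp only [mulHom_mk, castHom_tensorObj_comm]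

theorem mulHom_one {n : ℕ} (a : K0Deg k n) : mulHom n 0 a (RepK0.mk (unitObj k)) = a := by
  induction a using RepK0.induction with
  | h0 => simp
  | hneg x hx => simp only [map_neg, AddMonoidHom.neg_apply, hx]
  | hadd x y hx hy => simp only [map_add, AddMonoidHom.add_apply, hx, hy]
  | hmk V => rw [mulHom_mk, mk_tensorObj_unit]

instance : GradedMonoid.GMul (K0Deg k) where
  mul a b := mulHom _ _ a b

instance : GradedMonoid.GOne (K0Deg k) where
  one := RepK0.mk (unitObj k)

theorem gmul_comm (a b : GradedMonoid (K0Deg k)) : a * b = b * a := by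
  obtain ⟨m, a⟩ := a
  obtain ⟨n, b⟩ := b
  refine (mk_castHom (Nat.add_comm m n) (mulHom m n a b)).trans ?_
  rw [mulHom_comm]
  rfl

theorem gmul_one (a : GradedMonoid (K0Deg k)) : a * 1 = a := by
  obtain ⟨m, a⟩ := a
  exact congrArg (GradedMonoid.mk m) (mulHom_one a)

/-- The graded pieces `K₀(k[S_n]-mod)` form a graded commutative ring. -/
instance : DirectSum.GCommRing (K0Deg k) where
  mul_zero a := map_zero _
  zero_mul b := by
    change mulHom _ _ 0 b = 0
    rw [map_zero, AddMonoidHom.zero_apply]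
  mul_add a b c := map_add _ _ _
  add_mul a b c := by
    change mulHom _ _ (a + b) c = mulHom _ _ a c + mulHom _ _ b c
    rw [map_add, AddMonoidHom.add_apply]
  one_mul a := by rw [gmul_comm, gmul_one]
  mul_one := gmul_one
  mul_assoc := by
    rintro ⟨m, a⟩ ⟨n, b⟩ ⟨p, c⟩
    refine (mk_castHom (Nat.add_assoc m n p) (mulHom (m + n) p (mulHom m n a b) c)).trans ?_
    rw [mulHom_assoc]
    rfl
  natCast n := n • RepK0.mk (unitObj k)
  natCast_zero := zero_smul _ _
  natCast_succ n := succ_nsmul _ _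
  intCast n := n • RepK0.mk (unitObj k)
  intCast_ofNat n := natCast_zsmul _ _
  intCast_negSucc_ofNat n := negSucc_zsmul _ _
  mul_comm := gmul_comm

end Ring

open scoped DirectSum

section Classes

variable (k : Type u) [Field k] [CharZero k]

/-- The Grothendieck ring `K₀(𝒯_k)` of the free tensor category `𝒯_k`, whose objects are the
finitely supported families of objects of `k[S_n]-mod`, `n ≥ 0`: the direct sum of the groups
`K₀(k[S_n]-mod)`, with the multiplication induced by the tensor product `tensorObj`. -/
abbrev TensorK0 : Type (u + 1) := ⨁ n, K0Deg k n

variable {k}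

/-- The class in `K₀(𝒯_k)` of an object of `k[S_n]-mod`. -/
def cls {n : ℕ} (V : FDRep k (Equiv.Perm (Fin n))) : TensorK0 k :=
  DirectSum.of (K0Deg k) n (RepK0.mk V)

variable (k)

/-- The sign representation of `S_n`. -/
def signRep (n : ℕ) : Representation k (Equiv.Perm (Fin n)) k where
  toFun g := ((Equiv.Perm.sign g : ℤ) : k) • LinearMap.id
  map_one' := by simp; rfl
  map_mul' g h := by
    ext
    simp [mul_comm]

/-- The class `x = [X]` of the generator of `𝒯_k`, the trivial representation of `S_1`. -/
def xClass : TensorK0 k := cls (FDRep.of (Representation.trivial k (Equiv.Perm (Fin 1)) k))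

/-- The class `λⁿx = [ΛⁿX]` of the sign representation of `S_n`. -/
def lambdaClass (n : ℕ) : TensorK0 k := cls (FDRep.of (signRep k n))

/-- The set of the classes of the simple objects of `𝒯_k`. A simple object is an irreducible
representation of one of the groups `S_n`. -/
def simpleClasses : Set (TensorK0 k) :=
  {y | ∃ (n : ℕ) (V : FDRep k (Equiv.Perm (Fin n))), IsIrreducible V.ρ ∧ y = cls V}

end Classes

end FreeTensor

end

/-!
Write `e n = λⁿx` and `h n` for the class of the trivial representation of `Sₙ`. The graded
endomorphism `f` fixes every `e n` and `h n`, by induction on `n`. Suppose this is known below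
`N`. The Koszul relation `∑ (-1)ᵃ e a * h b = 0` over `a + b = N` gives
`f (h N) - h N = (-1)ᴺ⁺¹ • d` with `d = f (e N) - e N`, while `E = e (N - 1) * x` and
`H = h (N - 1) * x` are fixed. As `f` preserves effective classes, adding `d` keeps `e N`, and
subtracting it keeps `E - e N`, effective, and likewise `h N` and `H - h N` up to the sign of `d`.
Two effective classes without a common constituent can only both stay effective after adding `d`
when `d` is itself effective; for `N > 3` this applies to both `d` and `-d`, so `d = 0`. For `N = 3`
it only leaves `d = 0` or `d = E - e 3`, an irreducible class, and in the latter case `-e 2 * h 2`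
would be effective in degree `4`.

The value at `g` of the character of the Koszul sum is `det (1 - P)` for the permutation matrix
`P` of `g`, expanded in principal minors, and this vanishes because `P` fixes a nonzero vector.

The characters of the products of the `h n` span the class functions on `Sₙ`: by Frobenius
reciprocity a class function orthogonal to all of them sums to zero over each Young subgroup, and
induction on the orbit partition shows that it vanishes. Since the Grothendieck group embeds in
the class functions, `f` is the identity.
-/

universe v

noncomputable section

namespace FreeTensor

open Representation
open scoped TensorProduct DirectSum

section EffectiveClasses

variable {k : Type u} [Field k] {G : Type*} [Group G]

theorem RepK0.mk_eq_zero_of_subsingleton (V : FDRep k G) [Subsingleton V] : RepK0.mk V = 0 := by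
  have h := RepK0.mk_eq_add (A := V) (B := V) (C := V) 0 0 (fun _ _ _ => Subsingleton.elim _ _)
    (fun x => ⟨fun _ => ⟨x, Subsingleton.elim _ _⟩, fun _ => Subsingleton.elim _ _⟩)
    (fun x => ⟨x, Subsingleton.elim _ _⟩)
  simpa using h

theorem RepK0.mk_prod (V W : FDRep k G) :
    RepK0.mk (FDRep.of (Representation.prod V.ρ W.ρ)) = RepK0.mk V + RepK0.mk W :=
  RepK0.mk_eq_add (B := FDRep.of (Representation.prod V.ρ W.ρ)) (IntertwiningMap.inl k V.ρ W.ρ)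
    (IntertwiningMap.snd k V.ρ W.ρ) LinearMap.inl_injective Function.Exact.inl_snd
    LinearMap.snd_surjective

theorem RepK0.mk_eq_mk_ker_add {U V : FDRep k G} {f : IntertwiningMap V.ρ U.ρ}
    (hf : Function.Surjective f) :
    RepK0.mk V = RepK0.mk (FDRep.of f.ker.toRepresentation) + RepK0.mk U :=
  RepK0.mk_eq_add (A := FDRep.of f.ker.toRepresentation) ⟨f.ker.toSubmodule.subtype, fun _ => rfl⟩
    f Subtype.val_injective (LinearMap.exact_subtype_ker_map f.toLinearMap) hf

theorem RepK0.mk_eq_mk_sub_add_mk_quotient {V : FDRep k G} (T : Subrepresentation V.ρ) :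
    RepK0.mk V = RepK0.mk (FDRep.of T.toRepresentation) +
      RepK0.mk (FDRep.of (quotient V.ρ T.toSubmodule T.apply_mem_toSubmodule)) :=
  RepK0.mk_eq_add (A := FDRep.of T.toRepresentation)
    (C := FDRep.of (quotient V.ρ T.toSubmodule T.apply_mem_toSubmodule))
    ⟨T.toSubmodule.subtype, fun _ => rfl⟩ ⟨T.toSubmodule.mkQ, fun _ => rfl⟩
    Subtype.val_injective (LinearMap.exact_subtype_mkQ _) (Submodule.mkQ_surjective _)

variable (k G) in
/-- The effective classes in the Grothendieck group: those of actual representations, as opposed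
to formal differences. -/
def effectiveClasses : AddSubmonoid (RepK0 k G) where
  carrier := Set.range RepK0.mk
  zero_mem' := ⟨FDRep.of (Representation.trivial k G PUnit.{u + 1}),
    have : Subsingleton (FDRep.of (Representation.trivial k G PUnit.{u + 1})) :=
      inferInstanceAs (Subsingleton PUnit)
    RepK0.mk_eq_zero_of_subsingleton _⟩
  add_mem' := by
    rintro _ _ ⟨V, rfl⟩ ⟨W, rfl⟩
    exact ⟨_, RepK0.mk_prod V W⟩

variable (k G) in
/-- The classes of the irreducible representations in the Grothendieck group. -/
def irreducibleClasses : Set (RepK0 k G) :=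
  {x | ∃ U : FDRep k G, IsIrreducible U.ρ ∧ RepK0.mk U = x}

theorem mk_mem_effectiveClasses (V : FDRep k G) : RepK0.mk V ∈ effectiveClasses k G :=
  ⟨V, rfl⟩

theorem mem_effectiveClasses_of_mem_irreducibleClasses {u : RepK0 k G}
    (hu : u ∈ irreducibleClasses k G) : u ∈ effectiveClasses k G := by
  obtain ⟨U, -, rfl⟩ := hu
  exact mk_mem_effectiveClasses U

theorem exists_effectiveClasses_sub_eq (x : RepK0 k G) :
    ∃ y ∈ effectiveClasses k G, ∃ z ∈ effectiveClasses k G, y - z = x := by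
  induction x using RepK0.induction with
  | h0 => exact ⟨0, zero_mem _, 0, zero_mem _, sub_self 0⟩
  | hmk V => exact ⟨_, mk_mem_effectiveClasses V, 0, zero_mem _, sub_zero _⟩
  | hneg x hx =>
    obtain ⟨y, hy, z, hz, rfl⟩ := hx
    exact ⟨z, hz, y, hy, (neg_sub y z).symm⟩
  | hadd x x' hx hx' =>
    obtain ⟨y, hy, z, hz, rfl⟩ := hx
    obtain ⟨y', hy', z', hz', rfl⟩ := hx'
    exact ⟨y + y', add_mem hy hy', z + z', add_mem hz hz', add_sub_add_comm y y' z z'⟩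

theorem exists_subrepresentation_ne_bot_ne_top {V : FDRep k G} (hV : Nontrivial V)
    (h : ¬IsIrreducible V.ρ) : ∃ T : Subrepresentation V.ρ, T ≠ ⊥ ∧ T ≠ ⊤ := by
  have : Nontrivial (Subrepresentation V.ρ) :=
    ⟨⊥, ⊤, fun h => bot_ne_top (α := Submodule k V) (congrArg Subrepresentation.toSubmodule h)⟩
  by_contra! hT
  exact h ⟨fun T => or_iff_not_imp_left.2 (hT T)⟩

theorem mk_mem_closure_irreducibleClasses (V : FDRep k G) :
    RepK0.mk V ∈ AddSubmonoid.closure (irreducibleClasses k G) := by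
  induction hn : Module.finrank k V using Nat.strong_induction_on generalizing V with
  | _ n ih =>
  obtain hV | hV := subsingleton_or_nontrivial V
  · rw [RepK0.mk_eq_zero_of_subsingleton V]
    exact zero_mem _
  by_cases hirr : IsIrreducible V.ρ
  · exact AddSubmonoid.subset_closure ⟨V, hirr, rfl⟩
  obtain ⟨T, hbot, htop⟩ := exists_subrepresentation_ne_bot_ne_top hV hirr
  have hsub : Module.finrank k T.toSubmodule < n :=
    hn ▸ Submodule.finrank_lt fun h => htop (Subrepresentation.toSubmodule_injective h)
  have hpos : Module.finrank k T.toSubmodule ≠ 0 := fun h =>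
    hbot (Subrepresentation.toSubmodule_injective (Submodule.finrank_eq_zero.1 h))
  have hquot := T.toSubmodule.finrank_quotient_add_finrank
  rw [RepK0.mk_eq_mk_sub_add_mk_quotient T]
  refine add_mem (ih _ hsub _ rfl) (ih _ ?_ _ rfl)
  change Module.finrank k (V ⧸ T.toSubmodule) < n
  omega

theorem closure_irreducibleClasses :
    AddSubmonoid.closure (irreducibleClasses k G) = effectiveClasses k G := by
  refine le_antisymm
    (AddSubmonoid.closure_le.2 fun _ => mem_effectiveClasses_of_mem_irreducibleClasses) ?_
  rintro _ ⟨V, rfl⟩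
  exact mk_mem_closure_irreducibleClasses V

theorem addMonoidHom_ext_irreducibleClasses {A : Type*} [AddGroup A] {φ ψ : RepK0 k G →+ A}
    (h : ∀ u ∈ irreducibleClasses k G, φ u = ψ u) : φ = ψ := by
  ext x
  obtain ⟨y, hy, z, hz, rfl⟩ := exists_effectiveClasses_sub_eq x
  rw [← closure_irreducibleClasses] at hy hz
  rw [map_sub, map_sub, AddMonoidHom.eqOn_closureM h hy, AddMonoidHom.eqOn_closureM h hz]

end EffectiveClasses

section Characters

variable {k : Type u} [Field k] {G : Type*} [Group G]

theorem character_eq_add_of_splitting {A B C : FDRep k G} {i : A →ₗ[k] B} {p : B →ₗ[k] C}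
    {r : B →ₗ[k] A} {s : C →ₗ[k] B} (hi : ∀ g a, i (A.ρ g a) = B.ρ g (i a))
    (hs : ∀ g c, s (C.ρ g c) = B.ρ g (s c)) (hri : ∀ a, r (i a) = a) (hps : ∀ c, p (s c) = c)
    (hsum : ∀ b, i (r b) + s (p b) = b) : B.character = A.character + C.character := by
  funext g
  have hB : B.ρ g = (B.ρ g ∘ₗ i) ∘ₗ r + (B.ρ g ∘ₗ s) ∘ₗ p :=
    LinearMap.ext fun b => by
      rw [LinearMap.add_apply]
      exact (congrArg (B.ρ g) (hsum b)).symm.trans (map_add _ _ _)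
  have hA : r ∘ₗ B.ρ g ∘ₗ i = A.ρ g :=
    LinearMap.ext fun a => (congrArg r (hi g a)).symm.trans (hri _)
  have hC : p ∘ₗ B.ρ g ∘ₗ s = C.ρ g :=
    LinearMap.ext fun c => (congrArg p (hs g c)).symm.trans (hps _)
  rw [Pi.add_apply, FDRep.character, FDRep.character, FDRep.character, hB, map_add,
    LinearMap.trace_comp_comm' r, LinearMap.trace_comp_comm' p, hA, hC]

/-- The character of a class in the Grothendieck group, extending the character of a
representation additively. -/
def charHom (k : Type u) [Field k] (G : Type*) [Group G] [CharZero k] [Finite G] :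
    RepK0 k G →+ (G → k) :=
  RepK0.lift FDRep.character fun A B C i p hi hip hp => by
    obtain ⟨r, s, -, hs, hri, hps, hsum⟩ := exists_splitting i p hi hip hp
    exact character_eq_add_of_splitting (i := i.toLinearMap) (p := p.toLinearMap)
      i.isIntertwining hs hri hps hsum

/-- The bilinear pairing `|G|⁻¹ ∑ g, φ g⁻¹ * ψ g` of functions on a finite group. For characters,
it is the dimension of the space of intertwining maps. -/
def charPair (k : Type*) [Field k] (G : Type*) [Group G] [Fintype G] :
    LinearMap.BilinForm k (G → k) :=
  LinearMap.mk₂ k (fun φ ψ => (Nat.card G : k)⁻¹ * ∑ g, φ g⁻¹ * ψ g)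
    (fun φ φ' ψ => by simp only [Pi.add_apply, add_mul, Finset.sum_add_distrib, mul_add])
    (fun c φ ψ => by
      simp only [Pi.smul_apply, smul_eq_mul, mul_assoc, ← Finset.mul_sum, mul_left_comm _ c])
    (fun φ ψ ψ' => by simp only [Pi.add_apply, mul_add, Finset.sum_add_distrib])
    (fun c φ ψ => by
      simp only [Pi.smul_apply, smul_eq_mul, ← Finset.mul_sum, mul_left_comm _ c])

theorem charPair_apply [Fintype G] (φ ψ : G → k) :
    charPair k G φ ψ = (Nat.card G : k)⁻¹ * ∑ g, φ g⁻¹ * ψ g :=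
  rfl

theorem charPair_comm [Fintype G] (φ ψ : G → k) : charPair k G φ ψ = charPair k G ψ φ := by
  rw [charPair_apply, charPair_apply, ← Equiv.sum_comp (Equiv.inv G)]
  simp only [Equiv.inv_apply, inv_inv, mul_comm]

variable [CharZero k]

theorem charHom_mk [Finite G] (V : FDRep k G) : charHom k G (RepK0.mk V) = V.character :=
  RepK0.lift_mk ..

variable [Fintype G]

theorem charPair_character (V W : FDRep k G) :
    charPair k G V.character W.character = Module.finrank k (IntertwiningMap V.ρ W.ρ) := by
  have : Invertible (Nat.card G : k) := invertibleOfNonzero (Nat.cast_ne_zero.2 Nat.card_pos.ne')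
  simp only [charPair_apply, mul_comm (V.character _)]
  exact card_inv_mul_sum_char_mul_char_eq_finrank V.ρ W.ρ

variable (k G) in
/-- The pairing on the Grothendieck group given by the dimension of the space of intertwining
maps. -/
def homPairing : RepK0 k G →+ RepK0 k G →+ ℤ :=
  have hadd {A B C : FDRep k G} (i : IntertwiningMap A.ρ B.ρ) (p : IntertwiningMap B.ρ C.ρ)
      (hi : Function.Injective i) (hip : Function.Exact i p) (hp : Function.Surjective p) :
      B.character = A.character + C.character := by
    rw [← charHom_mk, ← charHom_mk, ← charHom_mk, ← map_add, RepK0.mk_eq_add i p hi hip hp]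
  RepK0.lift
    (fun U => RepK0.lift (fun V => (Module.finrank k (IntertwiningMap U.ρ V.ρ) : ℤ))
      fun A B C i p hi hip hp => by
        rw [← Int.cast_inj (α := k), Int.cast_add]
        simp only [Int.cast_natCast, ← charPair_character, hadd i p hi hip hp, map_add])
    fun A B C i p hi hip hp => by
      ext x
      induction x using RepK0.induction with
      | h0 => simp only [map_zero]
      | hneg x hx => simp only [map_neg, hx]
      | hadd x y hx hy => simp only [map_add, hx, hy]
      | hmk V =>
        rw [AddMonoidHom.add_apply, RepK0.lift_mk, RepK0.lift_mk, RepK0.lift_mk,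
          ← Int.cast_inj (α := k), Int.cast_add]
        simp only [Int.cast_natCast, ← charPair_character, hadd i p hi hip hp, map_add,
          LinearMap.add_apply]

theorem homPairing_mk_mk (U V : FDRep k G) :
    homPairing k G (RepK0.mk U) (RepK0.mk V) = Module.finrank k (IntertwiningMap U.ρ V.ρ) := by
  rw [homPairing, RepK0.lift_mk, RepK0.lift_mk]

theorem charPair_charHom (x y : RepK0 k G) :
    charPair k G (charHom k G x) (charHom k G y) = homPairing k G x y := by
  obtain ⟨_, ⟨V, rfl⟩, _, ⟨V', rfl⟩, rfl⟩ := exists_effectiveClasses_sub_eq x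
  obtain ⟨_, ⟨W, rfl⟩, _, ⟨W', rfl⟩, rfl⟩ := exists_effectiveClasses_sub_eq y
  simp only [map_sub, LinearMap.sub_apply, AddMonoidHom.sub_apply, charHom_mk, charPair_character,
    homPairing_mk_mk, Int.cast_sub, Int.cast_natCast]

theorem homPairing_comm (x y : RepK0 k G) : homPairing k G x y = homPairing k G y x := by
  rw [← Int.cast_inj (α := k), ← charPair_charHom, ← charPair_charHom, charPair_comm]

theorem homPairing_nonneg {x y : RepK0 k G} (hx : x ∈ effectiveClasses k G)
    (hy : y ∈ effectiveClasses k G) : 0 ≤ homPairing k G x y := by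
  obtain ⟨V, rfl⟩ := hx
  obtain ⟨W, rfl⟩ := hy
  rw [homPairing_mk_mk]
  positivity

theorem homPairing_mk_self_pos (V : FDRep k G) [Nontrivial V] :
    0 < homPairing k G (RepK0.mk V) (RepK0.mk V) := by
  obtain ⟨v, hv⟩ := exists_ne (0 : V)
  have : Nontrivial (IntertwiningMap V.ρ V.ρ) :=
    ⟨IntertwiningMap.id V.ρ, 0, fun h => hv (DFunLike.congr_fun h v)⟩
  rw [homPairing_mk_mk]
  exact_mod_cast Module.finrank_pos

theorem homPairing_self_pos {x : RepK0 k G} (hx : x ∈ effectiveClasses k G) (h0 : x ≠ 0) :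
    0 < homPairing k G x x := by
  obtain ⟨V, rfl⟩ := hx
  obtain hV | hV := subsingleton_or_nontrivial V
  · exact absurd (RepK0.mk_eq_zero_of_subsingleton V) h0
  · exact homPairing_mk_self_pos V

variable {u : RepK0 k G}

theorem homPairing_self_pos_of_mem_irreducibleClasses (hu : u ∈ irreducibleClasses k G) :
    0 < homPairing k G u u := by
  obtain ⟨U, hU, rfl⟩ := hu
  obtain hV | hV := subsingleton_or_nontrivial U
  · exact absurd (Subrepresentation.toSubmodule_injective (Subsingleton.elim _ _))
      (bot_ne_top (α := Subrepresentation U.ρ))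
  · exact homPairing_mk_self_pos U

theorem sub_mem_effectiveClasses_of_homPairing_ne_zero (hu : u ∈ irreducibleClasses k G)
    {x : RepK0 k G} (hx : x ∈ effectiveClasses k G) (h : homPairing k G u x ≠ 0) :
    x - u ∈ effectiveClasses k G := by
  obtain ⟨U, hU, rfl⟩ := hu
  obtain ⟨V, rfl⟩ := hx
  rw [homPairing_comm, homPairing_mk_mk, Nat.cast_ne_zero] at h
  have : Nontrivial (IntertwiningMap V.ρ U.ρ) :=
    Module.nontrivial_of_finrank_pos (Nat.pos_of_ne_zero h)
  obtain ⟨f, hf⟩ := exists_ne (0 : IntertwiningMap V.ρ U.ρ)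
  rw [RepK0.mk_eq_mk_ker_add ((IsIrreducible.surjective_or_eq_zero f).resolve_right hf),
    add_sub_cancel_right]
  exact mk_mem_effectiveClasses _

theorem sub_mem_effectiveClasses {x y : RepK0 k G} (hx : x ∈ effectiveClasses k G)
    (hy : y ∈ effectiveClasses k G)
    (h : ∀ u ∈ irreducibleClasses k G, homPairing k G u y ≤ homPairing k G u x) :
    x - y ∈ effectiveClasses k G := by
  rw [← closure_irreducibleClasses] at hy
  induction hy using AddSubmonoid.closure_induction_left generalizing x with
  | zero => rwa [sub_zero]
  | add_left u hu y hy ih =>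
    rw [closure_irreducibleClasses] at hy
    have hu' := mem_effectiveClasses_of_mem_irreducibleClasses hu
    have hux : homPairing k G u u + homPairing k G u y ≤ homPairing k G u x := by
      rw [← map_add]; exact h u hu
    have hpos := homPairing_self_pos_of_mem_irreducibleClasses hu
    have hnonneg := homPairing_nonneg hu' hy
    rw [← sub_sub]
    refine ih (sub_mem_effectiveClasses_of_homPairing_ne_zero hu hx (by lia)) fun v hv => ?_
    have hv := h v hv
    rw [map_add] at hv
    rw [map_sub]
    lia

theorem mem_effectiveClasses_iff {x : RepK0 k G} :
    x ∈ effectiveClasses k G ↔ ∀ u ∈ irreducibleClasses k G, 0 ≤ homPairing k G u x := by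
  refine ⟨fun hx u hu =>
    homPairing_nonneg (mem_effectiveClasses_of_mem_irreducibleClasses hu) hx, fun h => ?_⟩
  obtain ⟨y, hy, z, hz, rfl⟩ := exists_effectiveClasses_sub_eq x
  simp only [map_sub, sub_nonneg] at h
  exact sub_mem_effectiveClasses hy hz h

omit [Fintype G] in
theorem eq_zero_of_mem_of_neg_mem_effectiveClasses [Finite G] {x : RepK0 k G}
    (hx : x ∈ effectiveClasses k G) (hx' : -x ∈ effectiveClasses k G) : x = 0 := by
  have := Fintype.ofFinite G
  by_contra h0
  have hpos := homPairing_self_pos hx h0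
  have hneg := homPairing_nonneg hx hx'
  rw [map_neg] at hneg
  lia

theorem eq_zero_of_homPairing_eq_zero {x : RepK0 k G}
    (h : ∀ u ∈ irreducibleClasses k G, homPairing k G u x = 0) : x = 0 :=
  eq_zero_of_mem_of_neg_mem_effectiveClasses (mem_effectiveClasses_iff.2 fun u hu => (h u hu).ge)
    (mem_effectiveClasses_iff.2 fun u hu => by rw [map_neg, h u hu, neg_zero])

theorem homPairing_eq_zero_of_ne {u v : RepK0 k G} (hu : u ∈ irreducibleClasses k G)
    (hv : v ∈ irreducibleClasses k G) (huv : u ≠ v) : homPairing k G u v = 0 := by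
  by_contra h
  refine huv (sub_eq_zero.1 (eq_zero_of_mem_of_neg_mem_effectiveClasses ?_ ?_))
  · exact sub_mem_effectiveClasses_of_homPairing_ne_zero hv
      (mem_effectiveClasses_of_mem_irreducibleClasses hu) (by rwa [homPairing_comm])
  · rw [neg_sub]
    exact sub_mem_effectiveClasses_of_homPairing_ne_zero hu
      (mem_effectiveClasses_of_mem_irreducibleClasses hv) h

theorem homPairing_eq_zero_or_eq_zero (hu : u ∈ irreducibleClasses k G) {x y : RepK0 k G}
    (hx : x ∈ effectiveClasses k G) (hy : y ∈ effectiveClasses k G)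
    (h : homPairing k G x y = 0) : homPairing k G u x = 0 ∨ homPairing k G u y = 0 := by
  by_contra! hc
  have hu' := mem_effectiveClasses_of_mem_irreducibleClasses hu
  have hxu := sub_mem_effectiveClasses_of_homPairing_ne_zero hu hx hc.1
  have hyu := sub_mem_effectiveClasses_of_homPairing_ne_zero hu hy hc.2
  have hpos := homPairing_self_pos_of_mem_irreducibleClasses hu
  have h₁ := homPairing_nonneg hxu hy
  have h₂ := homPairing_nonneg hu' hyu
  rw [map_sub, AddMonoidHom.sub_apply, h] at h₁
  rw [map_sub] at h₂
  lia

theorem mem_effectiveClasses_of_add_mem {x y d : RepK0 k G} (hx : x ∈ effectiveClasses k G)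
    (hy : y ∈ effectiveClasses k G) (hxy : homPairing k G x y = 0)
    (hxd : x + d ∈ effectiveClasses k G) (hyd : y + d ∈ effectiveClasses k G) :
    d ∈ effectiveClasses k G := by
  refine mem_effectiveClasses_iff.2 fun u hu => ?_
  obtain h | h := homPairing_eq_zero_or_eq_zero hu hx hy hxy
  · simpa only [map_add, h, zero_add] using mem_effectiveClasses_iff.1 hxd u hu
  · simpa only [map_add, h, zero_add] using mem_effectiveClasses_iff.1 hyd u hu

theorem eq_zero_or_eq_zero_of_homPairing_add_self_eq_one {x y : RepK0 k G}
    (hx : x ∈ effectiveClasses k G) (hy : y ∈ effectiveClasses k G)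
    (h : homPairing k G (x + y) (x + y) = 1) : x = 0 ∨ y = 0 := by
  by_contra! hne
  have hxpos := homPairing_self_pos hx hne.1
  have hypos := homPairing_self_pos hy hne.2
  have hxy := homPairing_nonneg hx hy
  have hyx := homPairing_nonneg hy hx
  simp only [map_add, AddMonoidHom.add_apply] at h
  lia

theorem mem_irreducibleClasses_of_homPairing_self_eq_one {x : RepK0 k G}
    (hx : x ∈ effectiveClasses k G) (h : homPairing k G x x = 1) : x ∈ irreducibleClasses k G := by
  rw [← closure_irreducibleClasses] at hx
  induction hx using AddSubmonoid.closure_induction with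
  | mem x hx => exact hx
  | zero => simp at h
  | add x y hx hy ihx ihy =>
    rw [closure_irreducibleClasses] at hx hy
    obtain rfl | rfl := eq_zero_or_eq_zero_of_homPairing_add_self_eq_one hx hy h
    · rw [zero_add] at h ⊢
      exact ihy h
    · rw [add_zero] at h ⊢
      exact ihx h

omit [Fintype G] in
theorem charHom_injective [Finite G] : Function.Injective (charHom k G) := by
  have := Fintype.ofFinite G
  refine (injective_iff_map_eq_zero _).2 fun x hx => eq_zero_of_homPairing_eq_zero fun u _ => ?_
  rw [← Int.cast_inj (α := k), ← charPair_charHom, hx, map_zero, Int.cast_zero]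

end Characters

section InducedFunctions

/-- The sum of a function over the fibre of `φ` above a point, that is, its pushforward along
`φ`. -/
def fiberSum {G H M : Type*} [Fintype G] [AddCommMonoid M] (φ : G → H) (f : G → M) (h : H) : M :=
  open Classical in ∑ g with φ g = h, f g

theorem fiberSum_eq_sum {G H M : Type*} [Fintype G] [DecidableEq H] [AddCommMonoid M] (φ : G → H)
    (f : G → M) (h : H) : fiberSum φ f h = ∑ g, if φ g = h then f g else 0 := by
  rw [fiberSum, Finset.sum_filter]
  congr! 2

theorem map_fiberSum {G H M N F : Type*} [Fintype G] [AddCommMonoid M] [AddCommMonoid N]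
    [FunLike F M N] [AddMonoidHomClass F M N] (l : F) (φ : G → H) (f : G → M) (h : H) :
    l (fiberSum φ f h) = fiberSum φ (fun g => l (f g)) h :=
  map_sum l _ _

theorem fiberSum_comp_of_injective {G H M : Type*} [Fintype G] [AddCommMonoid M] {φ : G → H}
    (hφ : Function.Injective φ) (f : H → M) [DecidablePred (· ∈ Set.range φ)] (h : H) :
    fiberSum φ (f ∘ φ) h = if h ∈ Set.range φ then f h else 0 := by
  classical
  rw [fiberSum_eq_sum]
  split_ifs with hh
  · obtain ⟨g, rfl⟩ := hh
    simp [hφ.eq_iff]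
  · exact Finset.sum_eq_zero fun g _ => if_neg fun hg => hh ⟨g, hg⟩

theorem fiberSum_prodMap {G H G' H' R : Type*} [Fintype G] [Fintype G']
    [NonUnitalNonAssocSemiring R] (φ : G → H) (φ' : G' → H') (f : G → R) (f' : G' → R)
    (h : H × H') : fiberSum (Prod.map φ φ') (fun x => f x.1 * f' x.2) h =
      fiberSum φ f h.1 * fiberSum φ' f' h.2 := by
  classical
  simp only [fiberSum_eq_sum, Finset.sum_mul_sum, Fintype.sum_prod_type, Prod.map_apply,
    Prod.ext_iff, ite_zero_mul_ite_zero]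

section ClassFunctions

variable {G H M : Type*} [Group G] [Group H]

/-- The functions on a group that are constant on conjugacy classes. -/
def IsClassFun (χ : G → M) : Prop := ∀ t g, χ (t * g * t⁻¹) = χ g

theorem IsClassFun.comp {χ : H → M} (hχ : IsClassFun χ) (φ : G →* H) :
    IsClassFun (χ ∘ φ) := fun t g => by
  simp only [Function.comp_apply, map_mul, map_inv, hχ (φ t)]

theorem isClassFun_monoidHom [CommMonoid M] (χ : G →* M) : IsClassFun χ := fun t g => by
  rw [map_mul, mul_comm, ← map_mul, inv_mul_cancel_left]

end ClassFunctions

variable {k G H L : Type*} [Field k] [Group G] [Group H] [Group L] [Fintype G] [Fintype H]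

/-- The induction of functions along a homomorphism `φ : G →* H`: it maps the character of a
representation of `G` to the character of the induced representation of `H`. -/
def inducedFun (φ : G →* H) : (G → k) →ₗ[k] (H → k) where
  toFun χ h := (Nat.card G : k)⁻¹ * ∑ t, fiberSum φ χ (t⁻¹ * h * t)
  map_add' χ ψ := by
    funext h
    simp only [fiberSum, Pi.add_apply, Finset.sum_add_distrib, mul_add]
  map_smul' a χ := by
    funext h
    simp only [fiberSum, Pi.smul_apply, ← Finset.smul_sum, mul_smul_comm, RingHom.id_apply]

theorem inducedFun_apply (φ : G →* H) (χ : G → k) (h : H) :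
    inducedFun φ χ h = (Nat.card G : k)⁻¹ * ∑ t, fiberSum φ χ (t⁻¹ * h * t) :=
  rfl

theorem isClassFun_inducedFun (φ : G →* H) (χ : G → k) :
    IsClassFun (inducedFun φ χ) := fun t h => by
  rw [inducedFun_apply, inducedFun_apply, ← Equiv.sum_comp (Equiv.mulLeft t)]
  simp only [Equiv.coe_mulLeft, mul_inv_rev, mul_assoc, inv_mul_cancel_left]

theorem inducedFun_comp_of_injective {φ : G →* H} (hφ : Function.Injective φ) (χ : H → k)
    [DecidablePred (· ∈ φ.range)] (h : H) :
    inducedFun φ (χ ∘ φ) h = (Nat.card φ.range : k)⁻¹ *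
      ∑ t, if t⁻¹ * h * t ∈ φ.range then χ (t⁻¹ * h * t) else 0 := by
  classical
  rw [inducedFun_apply, Nat.card_congr (MonoidHom.ofInjective hφ).toEquiv]
  simp only [fiberSum_comp_of_injective hφ]
  congr! 3

theorem inducedFun_prodMap {G' H' : Type*} [Group G'] [Group H'] [Fintype G'] [Fintype H']
    (φ : G →* H) (φ' : G' →* H') (χ : G → k) (χ' : G' → k) (h : H × H') :
    inducedFun (φ.prodMap φ') (fun x => χ x.1 * χ' x.2) h =
      inducedFun φ χ h.1 * inducedFun φ' χ' h.2 := by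
  simp only [inducedFun_apply, MonoidHom.coe_prodMap, fiberSum_prodMap, Fintype.sum_prod_type,
    Nat.card_prod, Nat.cast_mul, mul_inv, mul_mul_mul_comm _ (∑ _, _), Finset.sum_mul_sum,
    Prod.fst_mul, Prod.snd_mul, Prod.fst_inv, Prod.snd_inv]

variable [CharZero k]

theorem charPair_inducedFun (φ : G →* H) (χ : G → k) {η : H → k} (hη : IsClassFun η) :
    charPair k H (inducedFun φ χ) η = charPair k G χ (η ∘ φ) := by
  classical
  have hfiber (t : H) : ∑ h, η h⁻¹ * fiberSum φ χ (t⁻¹ * h * t) = ∑ g, η (φ g)⁻¹ * χ g := by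
    simp only [fiberSum_eq_sum, Finset.mul_sum]
    rw [Finset.sum_comm]
    refine Finset.sum_congr rfl fun g _ => ?_
    rw [Finset.sum_eq_single (t * φ g * t⁻¹)]
    · rw [if_pos (by group), ← hη t (φ g)⁻¹]
      simp only [mul_inv_rev, inv_inv, mul_assoc]
    · intro h _ hh
      rw [if_neg fun hg => hh (by rw [hg]; group), mul_zero]
    · simp
  rw [charPair_comm, charPair_comm χ, charPair_apply, charPair_apply]
  simp only [inducedFun_apply, mul_left_comm (η _), ← Finset.mul_sum, Function.comp_apply, map_inv]
  simp_rw [Finset.mul_sum Finset.univ (fun _ : H => fiberSum φ χ _)]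
  rw [Finset.sum_comm]
  simp only [hfiber, Finset.sum_const, Finset.card_univ, nsmul_eq_mul, Nat.card_eq_fintype_card]
  field_simp

theorem IsClassFun.eq_of_charPair_eq {χ ψ : G → k} (hχ : IsClassFun χ)
    (hψ : IsClassFun ψ) (h : ∀ η, IsClassFun η → charPair k G χ η = charPair k G ψ η) :
    χ = ψ := by
  classical
  funext g
  have hsum (ξ : G → k) (hξ : IsClassFun ξ) :
      charPair k G ξ (fun x => if IsConj g⁻¹ x then 1 else 0) =
        (Nat.card G : k)⁻¹ * (Finset.card {x | IsConj g⁻¹ x} * ξ g) := by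
    rw [charPair_apply]
    simp only [mul_ite, mul_one, mul_zero, ← Finset.sum_filter]
    rw [Finset.sum_congr rfl (g := fun _ => ξ g), Finset.sum_const, nsmul_eq_mul]
    intro x hx
    obtain ⟨t, rfl⟩ := isConj_iff.1 (Finset.mem_filter.1 hx).2
    rw [← hξ t g]
    simp only [mul_inv_rev, inv_inv, mul_assoc]
  have hcard : (Finset.card {x | IsConj g⁻¹ x} : k) ≠ 0 :=
    Nat.cast_ne_zero.2 <| Finset.card_ne_zero_of_mem
      (Finset.mem_filter.2 ⟨Finset.mem_univ g⁻¹, .refl _⟩)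
  have key := h (fun x => if IsConj g⁻¹ x then 1 else 0) fun t x => by
    have hx : IsConj x (t * x * t⁻¹) := isConj_iff.2 ⟨t, rfl⟩
    exact if_congr ⟨fun h => h.trans hx.symm, fun h => h.trans hx⟩ rfl rfl
  rw [hsum χ hχ, hsum ψ hψ] at key
  exact mul_left_cancel₀ hcard (mul_left_cancel₀ (by simp) key)

theorem inducedFun_inducedFun [Fintype L] (ψ : H →* L) (φ : G →* H) (χ : G → k) :
    inducedFun ψ (inducedFun φ χ) = inducedFun (ψ.comp φ) χ :=
  (isClassFun_inducedFun ψ _ : IsClassFun _).eq_of_charPair_eq (isClassFun_inducedFun _ χ)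
    fun η hη => by
    rw [charPair_inducedFun _ _ hη, charPair_inducedFun _ _ (hη.comp ψ),
      charPair_inducedFun _ _ hη]
    rfl

end InducedFunctions

section InducedCharacter

variable {k G H A : Type*} [Field k] [Group G] [Fintype G] [Group H] (φ : G →* H)
  [AddCommGroup A] [Module k A] (ρ : Representation k G A)

theorem fiberSum_mul_map (h : H) (g : G) :
    fiberSum φ ρ (h * φ g) = fiberSum φ ρ h ∘ₗ ρ g := by
  classical
  simp only [fiberSum_eq_sum, ← Module.End.mul_eq_comp, Finset.sum_mul]
  rw [← Equiv.sum_comp (Equiv.mulRight g)]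
  simp only [Equiv.coe_mulRight, map_mul, mul_left_inj, ite_mul, zero_mul]

/-- The projection of an induced representation to the subspace from which it is induced. -/
def indProj : IndV φ ρ →ₗ[k] A :=
  Coinvariants.lift _
    (TensorProduct.lift <| (Finsupp.lift _ _ _ fun h => fiberSum φ ρ h⁻¹) ∘ₗ
      (MonoidAlgebra.coeffLinearEquiv k).toLinearMap)
    fun g ↦ by
      ext h x
      have := LinearMap.congr_fun (fiberSum_mul_map φ ρ (h⁻¹ * (φ g)⁻¹) g) x
      simp only [inv_mul_cancel_right, LinearMap.comp_apply] at this
      simp [ofMulAction_single, mul_inv_rev, this]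

theorem indProj_ind (h : H) (a : A) :
    indProj φ ρ (ind φ ρ h (IndV.mk φ ρ 1 a)) = fiberSum φ ρ h a := by
  rw [ind_mk]
  simp [indProj]

variable [Fintype H]

theorem sum_ind_indProj (z : IndV φ ρ) :
    ∑ t : H, ind φ ρ t (IndV.mk φ ρ 1 (indProj φ ρ (ind φ ρ t⁻¹ z))) =
      (Nat.card G : k) • z := by
  classical
  induction z using ind_induction with
  | h0 => simp
  | hadd x y hx hy => simp only [map_add, Finset.sum_add_distrib, hx, hy, smul_add]
  | h1 s a =>
    set z := ind φ ρ s (IndV.mk φ ρ 1 a)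
    have hterm (t : H) : ind φ ρ t (IndV.mk φ ρ 1 (indProj φ ρ (ind φ ρ t⁻¹ z))) =
        ∑ g : G, if t = s * (φ g)⁻¹ then z else 0 := by
      rw [← Module.End.mul_apply (ind φ ρ t⁻¹), ← map_mul, indProj_ind, fiberSum_eq_sum,
        LinearMap.sum_apply, map_sum, map_sum]
      refine Finset.sum_congr rfl fun g _ => ?_
      rw [if_congr (eq_mul_inv_iff_mul_eq.trans eq_inv_mul_iff_mul_eq.symm) rfl rfl]
      split_ifs with hg
      · rw [← ind_mk_one, hg, ← Module.End.mul_apply, ← map_mul, mul_inv_cancel_left]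
      · simp
    rw [Finset.sum_congr rfl fun t _ => hterm t, Finset.sum_comm]
    simp [Nat.card_eq_fintype_card, Nat.cast_smul_eq_nsmul]

theorem character_ind [CharZero k] [Module.Finite k A] :
    Representation.character (ind φ ρ) = inducedFun φ (Representation.character ρ) := by
  funext h
  have hind : (Nat.card G : k) • ind φ ρ h =
      ∑ t : H, (ind φ ρ (h * t) ∘ₗ IndV.mk φ ρ 1) ∘ₗ (indProj φ ρ ∘ₗ ind φ ρ t⁻¹) := by
    refine LinearMap.ext fun z => ?_
    rw [LinearMap.smul_apply, ← map_smul, ← sum_ind_indProj, map_sum, LinearMap.sum_apply]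
    refine Finset.sum_congr rfl fun t _ => ?_
    rw [map_mul]
    rfl
  have hswap (t : H) : (indProj φ ρ ∘ₗ ind φ ρ t⁻¹) ∘ₗ (ind φ ρ (h * t) ∘ₗ IndV.mk φ ρ 1) =
      fiberSum φ ρ (t⁻¹ * h * t) := by
    refine LinearMap.ext fun a => ?_
    rw [← indProj_ind, mul_assoc, map_mul _ t⁻¹]
    rfl
  rw [inducedFun_apply, eq_inv_mul_iff_mul_eq₀ (Nat.cast_ne_zero.2 Nat.card_pos.ne'),
    Representation.character, ← smul_eq_mul, ← map_smul, hind, map_sum]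
  refine Finset.sum_congr rfl fun t _ => ?_
  rw [LinearMap.trace_comp_comm', hswap, map_fiberSum]
  rfl

end InducedCharacter

section ProductCharacter

theorem character_outer {k G H A B : Type*} [Field k] [Group G] [Group H] [AddCommGroup A]
    [Module k A] [Module.Finite k A] [AddCommGroup B] [Module k B] [Module.Finite k B]
    (ρ : Representation k G A) (σ : Representation k H B) (x : G × H) :
    Representation.character (outer ρ σ) x =
      Representation.character ρ x.1 * Representation.character σ x.2 :=
  LinearMap.trace_tensorProduct' (ρ x.1) (σ x.2)

theorem charHom_mulHom {k : Type u} [Field k] [CharZero k] {m n : ℕ} (a : K0Deg k m)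
    (b : K0Deg k n) : charHom k _ (mulHom m n a b) =
      inducedFun (youngHom m n) fun x => charHom k _ a x.1 * charHom k _ b x.2 := by
  obtain ⟨_, ⟨V, rfl⟩, _, ⟨V', rfl⟩, rfl⟩ := exists_effectiveClasses_sub_eq a
  obtain ⟨_, ⟨W, rfl⟩, _, ⟨W', rfl⟩, rfl⟩ := exists_effectiveClasses_sub_eq b
  have key (V : FDRep k (Equiv.Perm (Fin m))) (W : FDRep k (Equiv.Perm (Fin n))) :
      charHom k _ (mulHom m n (RepK0.mk V) (RepK0.mk W)) =
        inducedFun (youngHom m n) fun x => V.character x.1 * W.character x.2 := by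
    rw [mulHom_mk, charHom_mk]
    refine (character_ind (youngHom m n) (outer V.ρ W.ρ)).trans (congrArg _ ?_)
    exact funext (character_outer V.ρ W.ρ)
  simp only [map_sub, AddMonoidHom.sub_apply, key, ← charHom_mk]
  simp only [← map_sub]
  congr 1
  funext x
  simp only [map_sub, Pi.sub_apply]
  ring

end ProductCharacter

section Coloring

variable {ι α : Type*}

/-- The Young subgroup of the permutations that preserve a coloring. -/
def colorStab (c : ι → α) : Subgroup (Equiv.Perm ι) where
  carrier := {s | ∀ i, c (s i) = c i}
  mul_mem' {a b} ha hb i := by rw [Equiv.Perm.mul_apply, ha, hb]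
  one_mem' _ := rfl
  inv_mem' {a} ha i := by rw [← ha (a⁻¹ i), ← Equiv.Perm.mul_apply, mul_inv_cancel]; rfl

instance [Finite ι] (c : ι → α) : Fintype (colorStab c) := Fintype.ofFinite _

theorem mem_colorStab {c : ι → α} {s : Equiv.Perm ι} : s ∈ colorStab c ↔ ∀ i, c (s i) = c i :=
  Iff.rfl

theorem mem_colorStab_comp {c : ι → α} {τ s : Equiv.Perm ι} :
    s ∈ colorStab (c ∘ τ) ↔ τ * s * τ⁻¹ ∈ colorStab c := by
  simp only [mem_colorStab, Function.comp_apply, Equiv.Perm.mul_apply]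
  exact ⟨fun h i => by simpa using h (τ⁻¹ i), fun h i => by simpa using h (τ i)⟩

theorem card_colorStab_comp (c : ι → α) (τ : Equiv.Perm ι) :
    Nat.card (colorStab (c ∘ τ)) = Nat.card (colorStab c) :=
  Nat.card_congr ((MulAut.conj τ).toEquiv.subtypeEquiv fun _ => mem_colorStab_comp)

theorem youngHom_injective (m n : ℕ) : Function.Injective (youngHom m n) :=
  finSumFinEquiv.permCongrHom.injective.comp Equiv.Perm.sumCongrHom_injective

theorem sign_youngHom {m n : ℕ} (x : Equiv.Perm (Fin m) × Equiv.Perm (Fin n)) :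
    Equiv.Perm.sign (youngHom m n x) = Equiv.Perm.sign x.1 * Equiv.Perm.sign x.2 := by
  have : youngHom m n x = finSumFinEquiv.permCongr (Equiv.Perm.sumCongr x.1 x.2) := rfl
  rw [this, Equiv.Perm.sign_permCongr, Equiv.Perm.sign_sumCongr]

theorem mem_range_youngHom {m n : ℕ} {w : Equiv.Perm (Fin (m + n))}
    (hw : ∀ i : Fin m, ∃ j : Fin m, w (Fin.castAdd n i) = Fin.castAdd n j) :
    w ∈ (youngHom m n).range := by
  have h : Set.MapsTo (finSumFinEquiv.permCongr.symm w)
      (Set.range (Sum.inl : Fin m → Fin m ⊕ Fin n)) (Set.range Sum.inl) := by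
    rintro _ ⟨i, rfl⟩
    obtain ⟨j, hj⟩ := hw i
    exact ⟨j, by simp [Equiv.permCongr_def, hj]⟩
  obtain ⟨x, hx⟩ := Equiv.Perm.mem_sumCongrHom_range_of_perm_mapsTo_inl h
  refine ⟨x, ?_⟩
  change finSumFinEquiv.permCongr (Equiv.Perm.sumCongrHom _ _ x) = w
  rw [hx, Equiv.apply_symm_apply]

theorem colorStab_eq_map {m n : ℕ} {c : Fin (m + n) → α}
    (hc : ∀ i j, c (Fin.castAdd n i) ≠ c (Fin.natAdd m j)) :
    colorStab c = ((colorStab (c ∘ Fin.castAdd n)).prod (colorStab (c ∘ Fin.natAdd m))).map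
      (youngHom m n) := by
  ext w
  rw [Subgroup.mem_map]
  constructor
  · intro hw
    obtain ⟨x, rfl⟩ := mem_range_youngHom (w := w) fun i => by
      have := hw (Fin.castAdd n i)
      generalize w (Fin.castAdd n i) = l at this ⊢
      induction l using Fin.addCases with
      | left j => exact ⟨j, rfl⟩
      | right j => exact absurd this.symm (hc i j)
    refine ⟨x, ⟨fun i => ?_, fun i => ?_⟩, rfl⟩
    · exact (congrArg c (youngHom_castAdd x.1 x.2 i).symm).trans (hw (Fin.castAdd n i))
    · exact (congrArg c (youngHom_natAdd x.1 x.2 i).symm).trans (hw (Fin.natAdd m i))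
  · rintro ⟨x, ⟨hx1, hx2⟩, rfl⟩ l
    induction l using Fin.addCases with
    | left j => rw [youngHom_castAdd]; exact hx1 j
    | right j => rw [youngHom_natAdd]; exact hx2 j

end Coloring

section YoungCharacters

variable {k ι α β : Type*} [Field k] [Fintype ι] [DecidableEq ι]

/-- The function induced from the restriction of a linear character to the Young subgroup of a
coloring. -/
def indChar (χ : Equiv.Perm ι →* k) (c : ι → α) : Equiv.Perm ι → k :=
  inducedFun (colorStab c).subtype (χ ∘ (colorStab c).subtype)

theorem isClassFun_indChar (χ : Equiv.Perm ι →* k) (c : ι → α) : IsClassFun (indChar χ c) :=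
  isClassFun_inducedFun _ _

theorem indChar_apply (χ : Equiv.Perm ι →* k) (c : ι → α) [DecidablePred (· ∈ colorStab c)]
    (g : Equiv.Perm ι) :
    indChar χ c g = χ g * ((Nat.card (colorStab c) : k)⁻¹ *
      ∑ t : Equiv.Perm ι, if t⁻¹ * g * t ∈ colorStab c then 1 else 0) := by
  classical
  have hχ (t : Equiv.Perm ι) : χ (t⁻¹ * g * t) = χ g := by
    simpa only [inv_inv] using isClassFun_monoidHom χ t⁻¹ g
  rw [indChar, inducedFun_comp_of_injective (colorStab c).subtype_injective]
  simp only [Subgroup.range_subtype, hχ, mul_left_comm (χ g)]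
  simp only [Finset.mul_sum, mul_ite, mul_one, mul_zero]

theorem indChar_comp (χ : Equiv.Perm ι →* k) (c : ι → α) (τ : Equiv.Perm ι) :
    indChar χ (c ∘ τ) = indChar χ c := by
  classical
  funext g
  rw [indChar_apply, indChar_apply, card_colorStab_comp,
    ← Equiv.sum_comp (Equiv.mulRight τ⁻¹) fun t => if t⁻¹ * g * t ∈ colorStab c then (1 : k) else 0]
  simp only [mem_colorStab_comp, Equiv.coe_mulRight, mul_inv_rev, inv_inv, mul_assoc]

variable [CharZero k]

theorem indChar_of_const (χ : Equiv.Perm ι →* k) {c : ι → α} (hc : ∀ i j, c i = c j) :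
    indChar χ c = χ := by
  classical
  funext g
  have h : colorStab c = ⊤ := top_unique fun s _ i => hc _ _
  have h0 : ((Fintype.card ι).factorial : k) ≠ 0 := Nat.cast_ne_zero.2 (Nat.factorial_ne_zero _)
  rw [indChar_apply]
  simp [h, Nat.card_eq_fintype_card, Fintype.card_perm, h0]

omit [CharZero k] in
variable (k ι) in
/-- The sign character with values in `k`. -/
def signChar : Equiv.Perm ι →* k :=
  ((Int.castRingHom k : ℤ →* k).comp (Units.coeHom ℤ)).comp Equiv.Perm.sign

omit [CharZero k] in
theorem signChar_apply (g : Equiv.Perm ι) : signChar k ι g = ((Equiv.Perm.sign g : ℤ) : k) :=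
  rfl

omit [CharZero k] in
theorem signChar_youngHom {m n : ℕ} (x : Equiv.Perm (Fin m) × Equiv.Perm (Fin n)) :
    signChar k _ (youngHom m n x) = signChar k _ x.1 * signChar k _ x.2 := by
  simp only [signChar_apply, sign_youngHom, Units.val_mul, Int.cast_mul]

theorem sum_signChar_colorStab (p : ι → α) [Decidable (Function.Injective p)] :
    ∑ s : colorStab p, signChar k ι s = if Function.Injective p then 1 else 0 := by
  classical
  split_ifs with hp
  · have : Subsingleton (colorStab p) :=
      subsingleton_of_forall_eq 1 fun s => Subtype.ext (Equiv.ext fun i => hp (s.2 i))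
    rw [Fintype.sum_subsingleton _ (1 : colorStab p), OneMemClass.coe_one, map_one]
  · obtain ⟨i, j, hij, hne⟩ := Function.not_injective_iff.1 hp
    have hswap : Equiv.swap i j ∈ colorStab p := fun l => by
      rw [Equiv.swap_apply_def]
      split_ifs with h1 h2
      · rw [h1, hij]
      · rw [h2, hij]
      · rfl
    refine (sum_hom_units ((signChar k ι).comp (colorStab p).subtype)).trans ?_
    rw [if_neg, Nat.cast_zero]
    intro h
    have := DFunLike.congr_fun h ⟨_, hswap⟩
    simp [signChar_apply, Equiv.Perm.sign_swap hne, neg_eq_iff_add_eq_zero,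
      one_add_one_eq_two] at this

theorem charPair_indChar_indChar (d : ι → β) (c : ι → α) :
    charPair k _ (indChar (signChar k ι) d) (indChar 1 c) =
      (Nat.card (colorStab d) : k)⁻¹ * ((Nat.card (colorStab c) : k)⁻¹ *
        Nat.card {t : Equiv.Perm ι // Function.Injective fun i => (d i, c (t i))}) := by
  classical
  have hsum (t : Equiv.Perm ι) :
      ∑ s : colorStab d, (if t⁻¹ * s * t ∈ colorStab c then signChar k ι s else 0) =
        if Function.Injective fun i => (d i, c (t⁻¹ i)) then 1 else 0 := by
    rw [← sum_signChar_colorStab (k := k), ← Finset.sum_filter]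
    have hmem (s : Equiv.Perm ι) : s ∈ colorStab (fun i => (d i, c (t⁻¹ i))) ↔
        s ∈ colorStab d ∧ t⁻¹ * s * t ∈ colorStab c := by
      have := mem_colorStab_comp (c := c) (τ := t⁻¹) (s := s)
      rw [inv_inv] at this
      simp only [← this, mem_colorStab, Prod.mk.injEq, Function.comp_apply, forall_and]
    refine Finset.sum_bij' (fun s hs => (⟨s, (hmem s).2 ⟨s.2, (Finset.mem_filter.1 hs).2⟩⟩ :
      colorStab _)) (fun s _ => ⟨s, ((hmem s).1 s.2).1⟩) ?_ ?_ ?_ ?_ ?_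
    · simp
    · exact fun s _ => Finset.mem_filter.2 ⟨Finset.mem_univ _, ((hmem s).1 s.2).2⟩
    all_goals simp
  have hinv (s : Equiv.Perm ι) : signChar k ι s⁻¹ = signChar k ι s := by simp [signChar_apply]
  rw [indChar, charPair_inducedFun _ _ (isClassFun_indChar 1 c), charPair_apply]
  simp only [Function.comp_apply, Subgroup.subtype_apply, InvMemClass.coe_inv, hinv, indChar_apply,
    MonoidHom.one_apply, one_mul, mul_left_comm (signChar k ι _), ← Finset.mul_sum]
  simp_rw [Finset.mul_sum Finset.univ (fun _ : Equiv.Perm ι => ite _ _ _), mul_ite, mul_one,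
    mul_zero]
  rw [Finset.sum_comm]
  simp only [hsum]
  rw [← Equiv.sum_comp (Equiv.inv _)]
  simp only [Equiv.inv_apply, inv_inv, Finset.sum_boole, Nat.card_eq_fintype_card,
    Fintype.card_subtype]

theorem charPair_indChar_indChar_eq_zero {d : ι → β} {c : ι → α}
    (h : ∀ t : Equiv.Perm ι, ¬ Function.Injective fun i => (d i, c (t i))) :
    charPair k _ (indChar (signChar k ι) d) (indChar 1 c) = 0 := by
  have : IsEmpty {t : Equiv.Perm ι // Function.Injective fun i => (d i, c (t i))} :=
    ⟨fun t => h t.1 t.2⟩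
  rw [charPair_indChar_indChar, Nat.card_eq_zero.2 (Or.inl this), Nat.cast_zero, mul_zero, mul_zero]

end YoungCharacters

section YoungProducts

variable {α : Type*}

theorem inducedFun_comp_congr {k G G' H : Type*} [Field k] [Group G] [Group G'] [Group H]
    [Fintype G] [Fintype G'] [Fintype H] {φ : G →* H} {φ' : G' →* H} (hφ : Function.Injective φ)
    (hφ' : Function.Injective φ') (h : φ.range = φ'.range) (χ : H → k) :
    inducedFun φ (χ ∘ φ) = inducedFun φ' (χ ∘ φ') := by
  classical
  funext x
  rw [inducedFun_comp_of_injective hφ, inducedFun_comp_of_injective hφ']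
  simp only [h]

variable {k : Type u} [Field k] [CharZero k]

theorem charHom_mulHom_eq_indChar {m n : ℕ} {χ : Equiv.Perm (Fin (m + n)) →* k}
    {χ₁ : Equiv.Perm (Fin m) →* k} {χ₂ : Equiv.Perm (Fin n) →* k}
    (hχ : ∀ x, χ (youngHom m n x) = χ₁ x.1 * χ₂ x.2) {a : K0Deg k m} {b : K0Deg k n}
    {c : Fin (m + n) → α} (hc : ∀ i j, c (Fin.castAdd n i) ≠ c (Fin.natAdd m j))
    (ha : charHom k _ a = indChar χ₁ (c ∘ Fin.castAdd n))
    (hb : charHom k _ b = indChar χ₂ (c ∘ Fin.natAdd m)) :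
    charHom k _ (mulHom m n a b) = indChar χ c := by
  let φ := (youngHom m n).comp
    ((colorStab (c ∘ Fin.castAdd n)).subtype.prodMap (colorStab (c ∘ Fin.natAdd m)).subtype)
  have hφ : Function.Injective φ := (youngHom_injective m n).comp
    ((Subgroup.subtype_injective _).prodMap (Subgroup.subtype_injective _))
  have hrange : φ.range = (colorStab c).subtype.range := by
    rw [Subgroup.range_subtype, colorStab_eq_map hc, MonoidHom.range_comp]
    congr 1
    ext x
    simp [Subgroup.mem_prod]
  rw [indChar, ← inducedFun_comp_congr hφ (Subgroup.subtype_injective _) hrange, charHom_mulHom,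
    ha, hb, ← inducedFun_inducedFun]
  congr 1
  funext x
  exact (inducedFun_prodMap _ _ _ _ x).symm.trans
    (congrArg (inducedFun _ · x) (funext fun y => (hχ (y.1, y.2)).symm))

theorem of_mul_of {m n : ℕ} (a : K0Deg k m) (b : K0Deg k n) :
    DirectSum.of (K0Deg k) m a * DirectSum.of (K0Deg k) n b =
      DirectSum.of (K0Deg k) (m + n) (mulHom m n a b) :=
  DirectSum.of_mul_of a b

theorem exists_perm_castAdd_mem_natAdd_notMem {m n : ℕ} {s : Finset (Fin (m + n))}
    (hs : s.card = m) :
    ∃ τ : Equiv.Perm (Fin (m + n)),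
      (∀ i, τ (Fin.castAdd n i) ∈ s) ∧ ∀ j, τ (Fin.natAdd m j) ∉ s := by
  have hs' : sᶜ.card = n := by
    rw [Finset.card_compl, Fintype.card_fin, hs, Nat.add_sub_cancel_left]
  refine ⟨finSumFinEquiv.symm.trans (finSumEquivOfFinset hs hs'), fun i => by simp, fun j => ?_⟩
  simp only [Equiv.trans_apply, finSumFinEquiv_symm_apply_natAdd, finSumEquivOfFinset_inr]
  exact Finset.mem_compl.1 (Finset.orderEmbOfFin_mem _ _ _)

theorem exists_mem_charHom_eq_indChar_one (R : Subring (TensorK0 k))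
    (hR : ∀ n, ∃ a : K0Deg k n, DirectSum.of (K0Deg k) n a ∈ R ∧ charHom k _ a = 1)
    {N : ℕ} (c : Fin N → α) :
    ∃ a : K0Deg k N, DirectSum.of (K0Deg k) N a ∈ R ∧ charHom k _ a = indChar 1 c := by
  classical
  induction N using Nat.strong_induction_on with
  | _ N ih =>
  by_cases hconst : ∀ i j, c i = c j
  · rw [indChar_of_const 1 hconst]
    exact hR N
  push Not at hconst
  obtain ⟨i, j, hij⟩ := hconst
  let s : Finset (Fin N) := {l | c l = c i}
  have mem_s (l : Fin N) : l ∈ s ↔ c l = c i := by simp [s]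
  have hm : 0 < s.card := Finset.card_pos.2 ⟨i, (mem_s i).2 rfl⟩
  have hn : 0 < sᶜ.card :=
    Finset.card_pos.2 ⟨j, Finset.mem_compl.2 fun h => hij ((mem_s j).1 h).symm⟩
  obtain ⟨m, hsm⟩ : ∃ m, s.card = m := ⟨_, rfl⟩
  obtain ⟨n, rfl⟩ : ∃ n, N = m + n :=
    ⟨sᶜ.card, by rw [← hsm, Finset.card_add_card_compl, Fintype.card_fin]⟩
  rw [Finset.card_compl, Fintype.card_fin] at hn
  obtain ⟨τ, hτs, hτs'⟩ := exists_perm_castAdd_mem_natAdd_notMem hsm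
  obtain ⟨a, haR, ha⟩ := ih m (by omega) ((c ∘ τ) ∘ Fin.castAdd n)
  obtain ⟨b, hbR, hb⟩ := ih n (by omega) ((c ∘ τ) ∘ Fin.natAdd m)
  refine ⟨mulHom m n a b, of_mul_of a b ▸ mul_mem haR hbR, ?_⟩
  rw [← indChar_comp 1 c τ]
  refine charHom_mulHom_eq_indChar (fun _ => (one_mul 1).symm) (fun p q h => hτs' q ?_) ha hb
  exact (mem_s _).2 (h.symm.trans ((mem_s _).1 (hτs p)))

end YoungProducts

section Orbits

variable {ι : Type*}

/-- The permutations that map every orbit of `g` onto itself. -/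
abbrev orbitStab (g : Equiv.Perm ι) : Subgroup (Equiv.Perm ι) :=
  colorStab (Quotient.mk (Equiv.Perm.SameCycle.setoid g))

theorem mem_orbitStab {g s : Equiv.Perm ι} : s ∈ orbitStab g ↔ ∀ i, g.SameCycle (s i) i :=
  forall_congr' fun _ => Quotient.eq

theorem self_mem_orbitStab (g : Equiv.Perm ι) : g ∈ orbitStab g :=
  mem_orbitStab.2 fun i => Equiv.Perm.sameCycle_apply_left.2 (Equiv.Perm.SameCycle.refl g i)

theorem swap_mem_orbitStab [DecidableEq ι] {g : Equiv.Perm ι} {i j : ι} :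
    Equiv.swap i j ∈ orbitStab g ↔ g.SameCycle i j := by
  refine ⟨fun h => ?_, fun h => mem_orbitStab.2 fun l => ?_⟩
  · simpa using mem_orbitStab.1 h j
  · rw [Equiv.swap_apply_def]
    split_ifs with h1 h2
    · exact h1 ▸ h.symm
    · exact h2 ▸ h
    · exact Equiv.Perm.SameCycle.refl g l

theorem orbitStab_le_of_mem {g s : Equiv.Perm ι} (h : s ∈ orbitStab g) :
    orbitStab s ≤ orbitStab g := by
  refine fun t ht => mem_orbitStab.2 fun i => ?_
  obtain ⟨n, hn⟩ := mem_orbitStab.1 ht i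
  have := mem_orbitStab.1 (zpow_mem h n) (t i)
  rw [hn] at this
  exact this.symm

variable [Fintype ι] [DecidableEq ι]

theorem image_support_cycleFactorsFinset (g : Equiv.Perm ι) :
    g.cycleFactorsFinset.image Equiv.Perm.support =
      g.support.image fun x => Finset.univ.filter fun y => g.SameCycle x y := by
  have support_cycleOf (x) (hx : x ∈ g.support) : (g.cycleOf x).support =
      Finset.univ.filter fun y => g.SameCycle x y := by
    ext y
    rw [Equiv.Perm.mem_support_cycleOf_iff, Finset.mem_filter]
    simp only [hx, and_true, Finset.mem_univ, true_and]
  ext S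
  simp only [Finset.mem_image]
  constructor
  · rintro ⟨c, hc, rfl⟩
    obtain ⟨x, hx⟩ := (Equiv.Perm.mem_cycleFactorsFinset_iff.1 hc).1.nonempty_support
    have hxg := Equiv.Perm.mem_cycleFactorsFinset_support_le hc hx
    exact ⟨x, hxg, by rw [← support_cycleOf x hxg, ← Equiv.Perm.cycle_is_cycleOf hx hc]⟩
  · rintro ⟨x, hx, rfl⟩
    exact ⟨g.cycleOf x, Equiv.Perm.cycleOf_mem_cycleFactorsFinset_iff.2 hx, support_cycleOf x hx⟩

theorem cycleType_eq_map_card_image_support (g : Equiv.Perm ι) :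
    g.cycleType = (g.cycleFactorsFinset.image Equiv.Perm.support).val.map Finset.card := by
  have hinj : Set.InjOn Equiv.Perm.support (g.cycleFactorsFinset : Set (Equiv.Perm ι)) := by
    intro c hc c' hc' h
    obtain ⟨x, hx⟩ := (Equiv.Perm.mem_cycleFactorsFinset_iff.1 hc).1.nonempty_support
    rw [Equiv.Perm.cycle_is_cycleOf hx hc, Equiv.Perm.cycle_is_cycleOf (h ▸ hx) hc']
  rw [Finset.image_val_of_injOn hinj, Multiset.map_map, Equiv.Perm.cycleType_def]

omit [Fintype ι] [DecidableEq ι] in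
theorem isConj_of_sameCycle_iff [Finite ι] {f g : Equiv.Perm ι}
    (h : ∀ x y, f.SameCycle x y ↔ g.SameCycle x y) : IsConj f g := by
  classical
  have := Fintype.ofFinite ι
  have hsupp : f.support = g.support := by
    ext x
    have hfix (w : Equiv.Perm ι) : x ∈ w.support ↔ ∃ y, y ≠ x ∧ w.SameCycle x y := by
      rw [Equiv.Perm.mem_support]
      exact ⟨fun hx => ⟨w x, hx, Equiv.Perm.sameCycle_apply_right.2 (.refl w x)⟩,
        fun ⟨y, hne, hy⟩ hx => hne (hy.eq_of_left hx).symm⟩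
    simp only [hfix, h]
  rw [Equiv.Perm.isConj_iff_cycleType_eq, cycleType_eq_map_card_image_support,
    cycleType_eq_map_card_image_support, image_support_cycleFactorsFinset,
    image_support_cycleFactorsFinset]
  simp only [hsupp, h]

omit [Fintype ι] [DecidableEq ι] in
theorem isConj_of_orbitStab_eq [Finite ι] {f g : Equiv.Perm ι} (h : orbitStab f = orbitStab g) :
    IsConj f g := by
  classical
  exact isConj_of_sameCycle_iff fun x y => by rw [← swap_mem_orbitStab, h, swap_mem_orbitStab]

/-- Induction on the orbit partition: the sum of `ζ` over `orbitStab g` is a positive multiple of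
`ζ g`, as the elements with strictly finer orbits contribute `0` and the others are conjugate to
`g`. -/
theorem IsClassFun.eq_zero_of_charPair_indChar_eq_zero {ι : Type v} [Fintype ι]
    [DecidableEq ι] {k : Type*} [Field k] [CharZero k] {ζ : Equiv.Perm ι → k} (hζ : IsClassFun ζ)
    (h : ∀ (α : Type v) (c : ι → α), charPair k _ (indChar 1 c) ζ = 0) : ζ = 0 := by
  classical
  suffices ∀ (P : Subgroup (Equiv.Perm ι)) (g : Equiv.Perm ι), orbitStab g = P → ζ g = 0 from
    funext fun g => this _ g rfl
  intro P
  induction P using WellFoundedLT.induction with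
  | ind P ih =>
  rintro g rfl
  have hsum : ∑ s : orbitStab g, ζ s = 0 := by
    have := h _ (Quotient.mk (Equiv.Perm.SameCycle.setoid g))
    rw [indChar, charPair_inducedFun _ _ hζ, charPair_apply] at this
    simpa [Fintype.card_ne_zero] using this
  have hterm (s : orbitStab g) : ζ s = if orbitStab (s : Equiv.Perm ι) = orbitStab g then ζ g
      else 0 := by
    split_ifs with hs
    · obtain ⟨t, ht⟩ := isConj_iff.1 (isConj_of_orbitStab_eq hs)
      rw [← hζ t s, ht]
    · exact ih _ ((orbitStab_le_of_mem s.2).lt_of_ne hs) s rfl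
  simp only [hterm, ← Finset.sum_filter, Finset.sum_const, nsmul_eq_mul, mul_eq_zero,
    Nat.cast_eq_zero, Finset.card_eq_zero] at hsum
  refine hsum.resolve_left (Finset.nonempty_iff_ne_empty.1 ⟨⟨g, self_mem_orbitStab g⟩, ?_⟩)
  simp

end Orbits

section Extension

variable {k : Type u} {G : Type*} [Field k] [CharZero k] [Group G]

theorem isClassFun_charHom [Finite G] (x : RepK0 k G) : IsClassFun (charHom k G x) := by
  obtain ⟨_, ⟨V, rfl⟩, _, ⟨W, rfl⟩, rfl⟩ := exists_effectiveClasses_sub_eq x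
  intro t g
  simp only [map_sub, charHom_mk, Pi.sub_apply, FDRep.char_conj]

theorem linearIndependent_charHom [Finite G] :
    LinearIndependent k fun u : irreducibleClasses k G => charHom k G u := by
  have := Fintype.ofFinite G
  refine LinearMap.BilinForm.linearIndependent_of_iIsOrtho (B := charPair k G)
    (fun u v huv => ?_) fun u hu => ?_
  · change charPair k G _ _ = 0
    rw [charPair_charHom, homPairing_eq_zero_of_ne u.2 v.2 (Subtype.coe_injective.ne huv),
      Int.cast_zero]
  · change charPair k G _ _ = 0 at hu
    rw [charPair_charHom, Int.cast_eq_zero] at hu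
    exact (homPairing_self_pos_of_mem_irreducibleClasses u.2).ne' hu

instance [Finite G] : Finite (irreducibleClasses k G) := linearIndependent_charHom.finite

theorem exists_isClassFun_charPair_charHom_eq [Fintype G] (φ : RepK0 k G →+ k) :
    ∃ ζ : G → k, IsClassFun ζ ∧ ∀ x, charPair k G ζ (charHom k G x) = φ x := by
  classical
  have := Fintype.ofFinite (irreducibleClasses k G)
  refine ⟨∑ u : irreducibleClasses k G, (φ u / homPairing k G u u) • charHom k G u, fun t g => ?_,
    DFunLike.congr_fun (addMonoidHom_ext_irreducibleClasses
      (φ := (charPair k G _).toAddMonoidHom.comp (charHom k G)) (ψ := φ) fun v hv => ?_)⟩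
  · simp only [Finset.sum_apply, Pi.smul_apply, isClassFun_charHom _ t g]
  · have hvv : (homPairing k G v v : k) ≠ 0 :=
      Int.cast_ne_zero.2 (homPairing_self_pos_of_mem_irreducibleClasses hv).ne'
    change charPair k G _ (charHom k G v) = φ v
    rw [map_sum, LinearMap.sum_apply, Finset.sum_eq_single ⟨v, hv⟩]
    · rw [map_smul, LinearMap.smul_apply, charPair_charHom, smul_eq_mul, div_mul_cancel₀ _ hvv]
    · intro u _ huv
      rw [map_smul, LinearMap.smul_apply, charPair_charHom,
        homPairing_eq_zero_of_ne u.2 hv (Subtype.coe_injective.ne huv), Int.cast_zero, smul_zero]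
    · simp

/-- An additive functional extends to a linear functional on class functions, so it vanishes when
it vanishes on classes whose characters span the class functions over `k`; these classes need not
generate the Grothendieck group. -/
theorem addMonoidHom_eq_zero_of_map_eq_zero {ι : Type v} [Fintype ι] [DecidableEq ι]
    {H : Type*} [Group H] [Finite H] {φ : RepK0 k (Equiv.Perm ι) →+ RepK0 k H}
    (h : ∀ (α : Type v) (c : ι → α), ∃ a, charHom k _ a = indChar 1 c ∧ φ a = 0) : φ = 0 := by
  ext x
  refine charHom_injective (funext fun t => ?_)
  obtain ⟨ζ, hζ, hζφ⟩ := exists_isClassFun_charPair_charHom_eq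
    ((Pi.evalAddMonoidHom _ t).comp ((charHom k H).comp φ))
  have hζ0 : ζ = 0 := hζ.eq_zero_of_charPair_indChar_eq_zero fun α c => by
    obtain ⟨a, ha, ha0⟩ := h α c
    rw [charPair_comm, ← ha, hζφ]
    simp [ha0]
  have := hζφ x
  rw [hζ0, map_zero, LinearMap.zero_apply] at this
  simpa using this.symm

end Extension

section SignAndTrivial

variable (k : Type u) [Field k]

/-- The class of the sign representation of `S_n`, that is, `λⁿx` as an element of degree `n`. -/
def signK0 (n : ℕ) : K0Deg k n := RepK0.mk (FDRep.of (signRep k n))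

/-- The class of the trivial representation of `S_n`. -/
def trivialK0 (n : ℕ) : K0Deg k n :=
  RepK0.mk (FDRep.of (Representation.trivial k (Equiv.Perm (Fin n)) k))

variable {k} [CharZero k]

theorem charHom_signK0 (n : ℕ) : charHom k _ (signK0 k n) = signChar k (Fin n) := by
  funext g
  rw [signK0, charHom_mk]
  change LinearMap.trace k k (((Equiv.Perm.sign g : ℤ) : k) • LinearMap.id) = _
  rw [map_smul, LinearMap.trace_id, Module.finrank_self, Nat.cast_one, smul_eq_mul, mul_one,
    signChar_apply]

theorem charHom_trivialK0 (n : ℕ) : charHom k _ (trivialK0 k n) = 1 := by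
  funext g
  rw [trivialK0, charHom_mk]
  refine (LinearMap.trace_id k k).trans ?_
  rw [Module.finrank_self, Nat.cast_one, Pi.one_apply]

variable (k) in
/-- The class `[SymⁿX]` of the trivial representation of `S_n` in `K₀(𝒯_k)`. -/
def symClass (n : ℕ) : TensorK0 k := DirectSum.of (K0Deg k) n (trivialK0 k n)

end SignAndTrivial

section Koszul

theorem exists_perm_map_eq {ι : Type*} [Finite ι] {s t : Finset ι} (h : s.card = t.card) :
    ∃ σ : Equiv.Perm ι, s.map σ.toEmbedding = t := by
  classical
  let e : {i // i ∈ s} ≃ {i // i ∈ t} := Finset.equivOfCardEq h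
  refine ⟨e.extendSubtype, Finset.eq_of_subset_of_card_le (fun _ hi => ?_) ?_⟩
  · obtain ⟨j, hj, rfl⟩ := Finset.mem_map.1 hi
    exact e.extendSubtype_mem j hj
  · rw [Finset.card_map, h]

theorem choose_mul_sum_perm_map {ι R : Type*} [Fintype ι] [DecidableEq ι] [CommSemiring R]
    (φ : Finset ι → R) (B : Finset ι) :
    ((Fintype.card ι).choose B.card : R) * ∑ t : Equiv.Perm ι, φ (B.map t.toEmbedding) =
      (Fintype.card ι).factorial * ∑ A ∈ Finset.univ.powersetCard B.card, φ A := by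
  have htrans (A : Finset ι) (hA : A ∈ Finset.univ.powersetCard B.card) :
      ∑ t : Equiv.Perm ι, φ (A.map t.toEmbedding) =
        ∑ t : Equiv.Perm ι, φ (B.map t.toEmbedding) := by
    obtain ⟨s, rfl⟩ := exists_perm_map_eq (Finset.mem_powersetCard.1 hA).2.symm
    rw [← Equiv.sum_comp (Equiv.mulRight s) fun t => φ (B.map t.toEmbedding)]
    simp only [Finset.map_map]
    rfl
  have hinv (t : Equiv.Perm ι) :
      ∑ A ∈ Finset.univ.powersetCard B.card, φ (A.map t.toEmbedding) =
        ∑ A ∈ Finset.univ.powersetCard B.card, φ A := by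
    conv_rhs => rw [← Finset.map_univ_equiv t, Finset.powersetCard_map, Finset.sum_map]
    rfl
  calc _ = ∑ A ∈ Finset.univ.powersetCard B.card, ∑ t : Equiv.Perm ι, φ (A.map t.toEmbedding) := by
        rw [Finset.sum_congr rfl htrans, Finset.sum_const, Finset.card_powersetCard,
          Finset.card_univ, nsmul_eq_mul]
    _ = _ := by
        rw [Finset.sum_comm, Finset.sum_congr rfl fun t _ => hinv t, Finset.sum_const,
          Finset.card_univ, Fintype.card_perm, nsmul_eq_mul]

/-- The sum over all subsets `A` of size `a` of the principal minors with index set `A`. -/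
def minorSum {ι R : Type*} [Fintype ι] [DecidableEq ι] [CommRing R] (M : Matrix ι ι R) (a : ℕ) :
    R :=
  ∑ A ∈ Finset.univ.powersetCard a, (M.submatrix (Subtype.val : A → ι) (Subtype.val : A → ι)).det

theorem det_one_sub_eq_sum_minorSum {ι R : Type*} [Fintype ι] [DecidableEq ι] [CommRing R]
    (M : Matrix ι ι R) : (1 - M).det = ∑ a ∈ Finset.range (Fintype.card ι + 1),
      (-1) ^ a * minorSum M a := by
  nontriviality R
  have heval : M.charpoly.eval 1 = (1 - M).det := by
    rw [Matrix.eval_charpoly, map_one]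
  rw [← heval, Polynomial.eval_eq_sum_range, M.charpoly_natDegree_eq_dim,
    ← Finset.sum_range_reflect]
  refine Finset.sum_congr rfl fun a ha => ?_
  rw [minorSum, Nat.add_sub_cancel, one_pow, mul_one,
    M.charpoly_coeff_eq_sum_minors a (Finset.mem_range_succ_iff.1 ha)]

theorem det_one_sub_permMatrix {ι R : Type*} [Fintype ι] [DecidableEq ι] [Nonempty ι]
    [CommRing R] [IsDomain R] (g : Equiv.Perm ι) : (1 - g.permMatrix R).det = 0 := by
  refine Matrix.exists_mulVec_eq_zero_iff.1 ⟨1, one_ne_zero, ?_⟩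
  rw [Matrix.sub_mulVec, Matrix.one_mulVec, Matrix.permMatrix_mulVec]
  exact sub_self _

theorem exists_youngHom_eq_iff {m n : ℕ} {σ : Equiv.Perm (Fin m)} {y : Equiv.Perm (Fin (m + n))} :
    (∃ τ, youngHom m n (σ, τ) = y) ↔ ∀ i, y (Fin.castAdd n i) = Fin.castAdd n (σ i) := by
  refine ⟨?_, fun h => ?_⟩
  · rintro ⟨τ, rfl⟩ i
    exact youngHom_castAdd σ τ i
  · obtain ⟨⟨σ', τ⟩, rfl⟩ := mem_range_youngHom fun i => ⟨σ i, h i⟩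
    have : σ = σ' := Equiv.ext fun i => by
      simpa only [youngHom_castAdd, Fin.castAdd_inj] using (h i).symm
    exact ⟨τ, by rw [this]⟩

theorem fiberSum_youngHom_signChar {k : Type*} [Field k] {m n : ℕ} (y : Equiv.Perm (Fin (m + n))) :
    fiberSum (youngHom m n) (fun x => signChar k (Fin m) x.1) y =
      ((y.permMatrix k).submatrix (Fin.castAdd n) (Fin.castAdd n)).det := by
  classical
  have hprod (σ : Equiv.Perm (Fin m)) :
      ∏ i, (y.permMatrix k).submatrix (Fin.castAdd n) (Fin.castAdd n) i (σ i) =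
        ∑ τ : Equiv.Perm (Fin n), if youngHom m n (σ, τ) = y then 1 else 0 := by
    have hentry (i : Fin m) :
        (y.permMatrix k).submatrix (Fin.castAdd n) (Fin.castAdd n) i (σ i) =
          if y (Fin.castAdd n i) = Fin.castAdd n (σ i) then 1 else 0 := by
      simp [PEquiv.toMatrix_apply, eq_comm]
    simp only [hentry, Fintype.prod_boole, ← exists_youngHom_eq_iff]
    split_ifs with h
    · obtain ⟨τ, rfl⟩ := h
      simp [(youngHom_injective m n).eq_iff]
    · exact (Finset.sum_eq_zero fun τ _ => if_neg fun hτ => h ⟨τ, hτ⟩).symm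
  rw [fiberSum_eq_sum, Fintype.sum_prod_type, ← Matrix.det_transpose, Matrix.det_apply']
  refine Finset.sum_congr rfl fun σ _ => ?_
  simp only [Matrix.transpose_apply]
  rw [hprod, Finset.mul_sum]
  simp only [mul_ite, mul_one, mul_zero]
  rfl

theorem permMatrix_conj {ι R : Type*} [DecidableEq ι] [Zero R] [One R] (g t : Equiv.Perm ι) :
    (t⁻¹ * g * t).permMatrix R = (g.permMatrix R).submatrix t t := by
  ext i j
  simp [PEquiv.toMatrix_apply, Equiv.symm_apply_eq, Equiv.Perm.inv_def]

theorem det_submatrix_coe_map_univ {ι κ R : Type*} [Fintype κ] [DecidableEq ι] [DecidableEq κ]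
    [CommRing R] (M : Matrix ι ι R) (f : κ ↪ ι) :
    (M.submatrix (Subtype.val : ↥(Finset.univ.map f) → ι) Subtype.val).det =
      (M.submatrix f f).det := by
  let e : κ ≃ ↥(Finset.univ.map f) :=
    Equiv.ofBijective (fun i => ⟨f i, Finset.mem_map_of_mem f (Finset.mem_univ i)⟩)
      ⟨fun i j h => f.injective (congrArg Subtype.val h), fun ⟨_, hi⟩ => by
        obtain ⟨j, -, rfl⟩ := Finset.mem_map.1 hi
        exact ⟨j, rfl⟩⟩
  exact (Matrix.det_submatrix_equiv_self e _).symm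

theorem charHom_mulHom_signK0_trivialK0 {k : Type u} [Field k] [CharZero k] (m n : ℕ)
    (g : Equiv.Perm (Fin (m + n))) :
    charHom k _ (mulHom m n (signK0 k m) (trivialK0 k n)) g = minorSum (g.permMatrix k) m := by
  let φ (A : Finset (Fin (m + n))) : k :=
    ((g.permMatrix k).submatrix (Subtype.val : A → _) (Subtype.val : A → _)).det
  have hminor (t : Equiv.Perm (Fin (m + n))) :
      fiberSum (youngHom m n) (fun x => signChar k (Fin m) x.1) (t⁻¹ * g * t) =
        φ ((Finset.univ.map (Fin.castAddEmb n)).map t.toEmbedding) := by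
    rw [fiberSum_youngHom_signChar, permMatrix_conj, Finset.map_map]
    exact (det_submatrix_coe_map_univ (g.permMatrix k)
      ((Fin.castAddEmb n).trans t.toEmbedding)).symm
  have hsum := choose_mul_sum_perm_map φ (Finset.univ.map (Fin.castAddEmb n))
  rw [Finset.card_map, Finset.card_univ, Fintype.card_fin, Fintype.card_fin,
    ← Nat.choose_mul_factorial_mul_factorial (Nat.le_add_right m n), Nat.add_sub_cancel_left,
    Nat.cast_mul, Nat.cast_mul, mul_assoc, mul_assoc] at hsum
  have h0 (l : ℕ) : (l.factorial : k) ≠ 0 := Nat.cast_ne_zero.2 l.factorial_ne_zero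
  have hchoose : ((m + n).choose m : k) ≠ 0 :=
    Nat.cast_ne_zero.2 (Nat.choose_pos (Nat.le_add_right m n)).ne'
  rw [charHom_mulHom, charHom_signK0, charHom_trivialK0, inducedFun_apply]
  simp only [Pi.one_apply, mul_one, hminor]
  rw [mul_left_cancel₀ hchoose hsum, Nat.card_prod, Nat.card_perm, Nat.card_perm, Nat.card_fin,
    Nat.card_fin, Nat.cast_mul, mul_inv, mul_mul_mul_comm, inv_mul_cancel₀ (h0 m), one_mul,
    inv_mul_cancel_left₀ (h0 n)]
  rfl

theorem exists_lambdaClass_mul_symClass_eq_of {k : Type u} [Field k] [CharZero k] {m n N : ℕ}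
    (h : m + n = N) : ∃ a : K0Deg k N, lambdaClass k m * symClass k n = DirectSum.of _ N a ∧
      ∀ g, charHom k _ a g = minorSum (g.permMatrix k) m := by
  subst h
  exact ⟨mulHom m n (signK0 k m) (trivialK0 k n), of_mul_of _ _,
    charHom_mulHom_signK0_trivialK0 m n⟩

theorem sum_lambdaClass_mul_symClass {k : Type u} [Field k] [CharZero k] {N : ℕ} (hN : 0 < N) :
    ∑ p ∈ Finset.HasAntidiagonal.antidiagonal N,
      (-1 : ℤ) ^ p.1 • (lambdaClass k p.1 * symClass k p.2) = 0 := by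
  have : Nonempty (Fin N) := ⟨⟨0, hN⟩⟩
  choose! a ha hchar using fun (p : ℕ × ℕ) (hp : p.1 + p.2 = N) =>
    exists_lambdaClass_mul_symClass_eq_of (k := k) hp
  have hzero : ∑ p ∈ Finset.HasAntidiagonal.antidiagonal N, (-1 : ℤ) ^ p.1 • a p = 0 := by
    apply charHom_injective
    funext g
    have hdet := det_one_sub_permMatrix (R := k) g
    rw [det_one_sub_eq_sum_minorSum, Fintype.card_fin,
      ← Finset.Nat.sum_antidiagonal_eq_sum_range_succ_mk
        fun p : ℕ × ℕ => (-1) ^ p.1 * minorSum (g.permMatrix k) p.1] at hdet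
    rw [map_sum, map_zero, Finset.sum_apply, Pi.zero_apply, ← hdet]
    refine Finset.sum_congr rfl fun p hp => ?_
    rw [map_zsmul, Pi.smul_apply, hchar p (Finset.HasAntidiagonal.mem_antidiagonal.1 hp)]
    simp
  rw [← map_zero (DirectSum.of (K0Deg k) N), ← hzero, map_sum]
  refine Finset.sum_congr rfl fun p hp => ?_
  rw [ha p (Finset.HasAntidiagonal.mem_antidiagonal.1 hp), map_zsmul]

end Koszul

section Pairings

variable {k ι α β : Type*} [Field k] [Fintype ι] [DecidableEq ι]

theorem charPair_monoidHom_self [CharZero k] {G : Type*} [Group G] [Fintype G] (χ : G →* k) :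
    charPair k G χ χ = 1 := by
  have hmul (g : G) : χ g⁻¹ * χ g = 1 := by rw [← map_mul, inv_mul_cancel, map_one]
  simp only [charPair_apply, hmul, Finset.sum_const, Finset.card_univ, nsmul_one,
    Nat.card_eq_fintype_card]
  exact inv_mul_cancel₀ (Nat.cast_ne_zero.2 Fintype.card_ne_zero)

theorem charPair_indChar_self [CharZero k] (χ : Equiv.Perm ι →* k) (c : ι → α) :
    charPair k _ (indChar χ c) χ = 1 := by
  rw [indChar, charPair_inducedFun _ _ (isClassFun_monoidHom χ)]
  exact charPair_monoidHom_self (χ.comp (colorStab c).subtype)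

theorem charPair_indChar_indChar_eq_zero_of_card [CharZero k] [DecidableEq α] [DecidableEq β]
    {d : ι → β} {c : ι → α} (b : β) (a : α)
    (h : Finset.card {i | d i ≠ b} + Finset.card {i | c i ≠ a} + 1 < Fintype.card ι) :
    charPair k _ (indChar (signChar k ι) d) (indChar 1 c) = 0 := by
  refine charPair_indChar_indChar_eq_zero fun t ht => ?_
  let s : Finset ι := {i | d i ≠ b}
  let r : Finset ι := {i | c (t i) ≠ a}
  have hr : r.card = Finset.card {i | c i ≠ a} := Finset.card_equiv t (by simp [r])
  have hunion : (s ∪ r).card ≤ s.card + r.card := Finset.card_union_le s r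
  have hcompl : (s ∪ r)ᶜ.card = Fintype.card ι - (s ∪ r).card := Finset.card_compl _
  obtain ⟨i, hi, j, hj, hij⟩ := Finset.one_lt_card.1 (show 1 < (s ∪ r)ᶜ.card by lia)
  simp only [s, r, Finset.mem_compl, Finset.mem_union, Finset.mem_filter, Finset.mem_univ,
    true_and, not_or, not_not] at hi hj
  exact hij (ht (Prod.ext (hi.1.trans hj.1.symm) (hi.2.trans hj.2.symm)))

end Pairings

section BlockColor

/-- The coloring of the block of the first `m` points by `false` and of the block of the last `n`
points by `true`. -/
def blockColor (m n : ℕ) : Fin (m + n) → Bool := Fin.addCases (fun _ => false) fun _ => true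

theorem card_blockColor_ne_false (m n : ℕ) : Finset.card {i | blockColor m n i ≠ false} = n := by
  rw [Finset.card_filter, Fin.sum_univ_add]
  simp [blockColor]

variable {k : Type u} [Field k] [CharZero k]

theorem charHom_mulHom_eq_indChar_blockColor {m n : ℕ} {χ : Equiv.Perm (Fin (m + n)) →* k}
    {χ₁ : Equiv.Perm (Fin m) →* k} {χ₂ : Equiv.Perm (Fin n) →* k}
    (hχ : ∀ x, χ (youngHom m n x) = χ₁ x.1 * χ₂ x.2) {a : K0Deg k m} {b : K0Deg k n}
    (ha : charHom k _ a = χ₁) (hb : charHom k _ b = χ₂) :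
    charHom k _ (mulHom m n a b) = indChar χ (blockColor m n) := by
  refine charHom_mulHom_eq_indChar hχ (fun i j => by simp [blockColor]) ?_ ?_
  · rw [ha, indChar_of_const]
    simp [blockColor]
  · rw [hb, indChar_of_const]
    simp [blockColor]

theorem charHom_mulHom_signK0 (m n : ℕ) :
    charHom k _ (mulHom m n (signK0 k m) (signK0 k n)) = indChar (signChar k _) (blockColor m n) :=
  charHom_mulHom_eq_indChar_blockColor signChar_youngHom (charHom_signK0 m) (charHom_signK0 n)

theorem charHom_mulHom_trivialK0 (m n : ℕ) :
    charHom k _ (mulHom m n (trivialK0 k m) (trivialK0 k n)) = indChar 1 (blockColor m n) :=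
  charHom_mulHom_eq_indChar_blockColor (χ₁ := 1) (χ₂ := 1) (fun _ => (one_mul 1).symm)
    (charHom_trivialK0 m) (charHom_trivialK0 n)

end BlockColor

section Effective

variable {k : Type u} [Field k]

theorem signK0_mem_effectiveClasses (n : ℕ) : signK0 k n ∈ effectiveClasses k _ :=
  mk_mem_effectiveClasses _

theorem trivialK0_mem_effectiveClasses (n : ℕ) : trivialK0 k n ∈ effectiveClasses k _ :=
  mk_mem_effectiveClasses _

variable [CharZero k]

theorem mulHom_mem_effectiveClasses {m n : ℕ} {a : K0Deg k m} {b : K0Deg k n}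
    (ha : a ∈ effectiveClasses k _) (hb : b ∈ effectiveClasses k _) :
    mulHom m n a b ∈ effectiveClasses k _ := by
  obtain ⟨V, rfl⟩ := ha
  obtain ⟨W, rfl⟩ := hb
  rw [mulHom_mk]
  exact mk_mem_effectiveClasses _

theorem sub_mem_effectiveClasses_of_charHom_eq_indChar {ι α : Type*} [Fintype ι] [DecidableEq ι]
    {χ : Equiv.Perm ι →* k} {c : ι → α} {x u : RepK0 k (Equiv.Perm ι)}
    (hx : x ∈ effectiveClasses k _) (hu : u ∈ effectiveClasses k _)
    (hxc : charHom k _ x = indChar χ c) (huχ : charHom k _ u = χ) :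
    x - u ∈ effectiveClasses k _ := by
  have hself : homPairing k _ u u = 1 := by
    rw [← Int.cast_inj (α := k), ← charPair_charHom, huχ, charPair_monoidHom_self, Int.cast_one]
  refine sub_mem_effectiveClasses_of_homPairing_ne_zero
    (mem_irreducibleClasses_of_homPairing_self_eq_one hu hself) hx ?_
  rw [homPairing_comm, ← Int.cast_ne_zero (α := k), ← charPair_charHom, hxc, huχ,
    charPair_indChar_self]
  exact one_ne_zero

theorem mulHom_signK0_sub_mem_effectiveClasses (m n : ℕ) :
    mulHom m n (signK0 k m) (signK0 k n) - signK0 k (m + n) ∈ effectiveClasses k _ :=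
  sub_mem_effectiveClasses_of_charHom_eq_indChar
    (mulHom_mem_effectiveClasses (signK0_mem_effectiveClasses m) (signK0_mem_effectiveClasses n))
    (signK0_mem_effectiveClasses _) (charHom_mulHom_signK0 m n) (charHom_signK0 _)

theorem mulHom_trivialK0_sub_mem_effectiveClasses (m n : ℕ) :
    mulHom m n (trivialK0 k m) (trivialK0 k n) - trivialK0 k (m + n) ∈ effectiveClasses k _ :=
  sub_mem_effectiveClasses_of_charHom_eq_indChar
    (mulHom_mem_effectiveClasses (trivialK0_mem_effectiveClasses m)
      (trivialK0_mem_effectiveClasses n))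
    (trivialK0_mem_effectiveClasses _) (charHom_mulHom_trivialK0 m n) (charHom_trivialK0 _)

end Effective

section SignTrivialPairings

variable {k : Type u} [Field k] [CharZero k]

theorem signK0_eq_trivialK0 {n : ℕ} (hn : n ≤ 1) : signK0 k n = trivialK0 k n := by
  have : Subsingleton (Fin n) := Fin.subsingleton_iff_le_one.2 hn
  refine charHom_injective ?_
  rw [charHom_signK0, charHom_trivialK0]
  funext g
  rw [Subsingleton.elim g 1, map_one, Pi.one_apply]

theorem charHom_signK0_eq_indChar (n : ℕ) :
    charHom k _ (signK0 k n) = indChar (signChar k (Fin n)) fun _ => () := by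
  rw [charHom_signK0, indChar_of_const _ fun _ _ => rfl]

theorem charHom_trivialK0_eq_indChar (n : ℕ) :
    charHom k _ (trivialK0 k n) = indChar 1 fun _ : Fin n => () := by
  rw [charHom_trivialK0, indChar_of_const _ fun _ _ => rfl]
  rfl

theorem homPairing_eq_zero_of_charHom_eq_indChar {ι α β : Type*} [Fintype ι] [DecidableEq ι]
    [DecidableEq α] [DecidableEq β] {x y : RepK0 k (Equiv.Perm ι)} {d : ι → β} {c : ι → α}
    (hx : charHom k _ x = indChar (signChar k ι) d) (hy : charHom k _ y = indChar 1 c) (b : β)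
    (a : α) (h : Finset.card {i | d i ≠ b} + Finset.card {i | c i ≠ a} + 1 < Fintype.card ι) :
    homPairing k _ x y = 0 := by
  rw [← Int.cast_inj (α := k), ← charPair_charHom, hx, hy,
    charPair_indChar_indChar_eq_zero_of_card b a h, Int.cast_zero]

theorem homPairing_signK0_trivialK0 {n : ℕ} (hn : 1 < n) :
    homPairing k _ (signK0 k n) (trivialK0 k n) = 0 :=
  homPairing_eq_zero_of_charHom_eq_indChar (charHom_signK0_eq_indChar n)
    (charHom_trivialK0_eq_indChar n) () () (by simpa using hn)

theorem homPairing_signK0_mulHom_trivialK0 {m : ℕ} (n : ℕ) (hm : 1 < m) :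
    homPairing k _ (signK0 k (m + n)) (mulHom m n (trivialK0 k m) (trivialK0 k n)) = 0 :=
  homPairing_eq_zero_of_charHom_eq_indChar (charHom_signK0_eq_indChar _)
    (charHom_mulHom_trivialK0 m n) () false (by
      rw [card_blockColor_ne_false, Fintype.card_fin]
      simp only [ne_eq, not_true_eq_false, Finset.filter_false, Finset.card_empty]
      lia)

theorem homPairing_mulHom_signK0_trivialK0 {m : ℕ} (n : ℕ) (hm : 1 < m) :
    homPairing k _ (mulHom m n (signK0 k m) (signK0 k n)) (trivialK0 k (m + n)) = 0 :=
  homPairing_eq_zero_of_charHom_eq_indChar (charHom_mulHom_signK0 m n)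
    (charHom_trivialK0_eq_indChar _) false () (by
      rw [card_blockColor_ne_false, Fintype.card_fin]
      simp only [ne_eq, not_true_eq_false, Finset.filter_false, Finset.card_empty]
      lia)

theorem homPairing_mulHom_signK0_mulHom_trivialK0 {m n : ℕ} (h : n + 1 < m) :
    homPairing k _ (mulHom m n (signK0 k m) (signK0 k n))
      (mulHom m n (trivialK0 k m) (trivialK0 k n)) = 0 :=
  homPairing_eq_zero_of_charHom_eq_indChar (charHom_mulHom_signK0 m n)
    (charHom_mulHom_trivialK0 m n) false false (by
      rw [card_blockColor_ne_false, Fintype.card_fin]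
      lia)

theorem homPairing_mulHom_two_one :
    homPairing k _ (mulHom 2 1 (signK0 k 2) (signK0 k 1))
      (mulHom 2 1 (trivialK0 k 2) (trivialK0 k 1)) = 1 := by
  have hstab : Nat.card (colorStab (blockColor 2 1)) = 2 := by
    change Nat.card {t : Equiv.Perm (Fin (2 + 1)) //
      ∀ i, blockColor 2 1 (t i) = blockColor 2 1 i} = 2
    rw [Nat.card_eq_fintype_card]
    decide
  have hinj : Nat.card {t : Equiv.Perm (Fin (2 + 1)) //
      Function.Injective fun i => (blockColor 2 1 i, blockColor 2 1 (t i))} = 4 := by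
    rw [Nat.card_eq_fintype_card]
    decide
  rw [← Int.cast_inj (α := k), ← charPair_charHom, charHom_mulHom_signK0,
    charHom_mulHom_trivialK0, charPair_indChar_indChar, hstab, hinj]
  norm_num

theorem minorSum_one {ι R : Type*} [Fintype ι] [DecidableEq ι] [CommRing R] (a : ℕ) :
    minorSum (1 : Matrix ι ι R) a = (Fintype.card ι).choose a := by
  simp [minorSum, Matrix.submatrix_one _ Subtype.val_injective]

theorem mulHom_signK0_trivialK0_ne_zero (m n : ℕ) :
    mulHom m n (signK0 k m) (trivialK0 k n) ≠ 0 := by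
  intro h
  have hchar := charHom_mulHom_signK0_trivialK0 (k := k) m n 1
  rw [h, map_zero, Pi.zero_apply, Matrix.permMatrix_one, minorSum_one,
    Fintype.card_fin] at hchar
  exact (Nat.choose_pos (Nat.le_add_right m n)).ne' (by exact_mod_cast hchar.symm)

end SignTrivialPairings

section Perturbation

variable {k : Type u} [Field k] [CharZero k] {G : Type*} [Group G] [Fintype G]
  {F : RepK0 k G →+ RepK0 k G} {e E h H s : RepK0 k G}

theorem map_eq_self_of_map_add_eq (hF : ∀ x ∈ effectiveClasses k G, F x ∈ effectiveClasses k G)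
    (he : e ∈ effectiveClasses k G) (heE : E - e ∈ effectiveClasses k G)
    (hh : h ∈ effectiveClasses k G) (hhH : H - h ∈ effectiveClasses k G) (hE : F E = E)
    (hH : F H = H) (heh : F (e + h) = e + h) (h₁ : homPairing k G e (H - h) = 0)
    (h₂ : homPairing k G (E - e) h = 0) : F e = e := by
  have hFh : F h = e + h - F e := by rw [← heh, map_add, add_sub_cancel_left]
  refine sub_eq_zero.1 (eq_zero_of_mem_of_neg_mem_effectiveClasses ?_ ?_)
  · refine mem_effectiveClasses_of_add_mem he hhH h₁ ?_ ?_
    · exact (add_sub_cancel e (F e)).symm ▸ hF e he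
    · have hFq : F (H - h) = H - h + (F e - e) := by rw [map_sub, hH, hFh]; abel
      exact hFq ▸ hF _ hhH
  · refine mem_effectiveClasses_of_add_mem heE hh h₂ ?_ ?_
    · have hFp : F (E - e) = E - e + -(F e - e) := by rw [map_sub, hE]; abel
      exact hFp ▸ hF _ heE
    · have hFh' : F h = h + -(F e - e) := by rw [hFh]; abel
      exact hFh' ▸ hF h hh

theorem map_eq_self_of_map_sub_eq (hF : ∀ x ∈ effectiveClasses k G, F x ∈ effectiveClasses k G)
    (he : e ∈ effectiveClasses k G) (heE : E - e ∈ effectiveClasses k G)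
    (hh : h ∈ effectiveClasses k G) (hhH : H - h ∈ effectiveClasses k G) (hE : F E = E)
    (hH : F H = H) (heh : F (h - e) = h - e) (h₁ : homPairing k G e h = 0)
    (h₂ : homPairing k G (E - e) (H - h) = 0) : F e = e := by
  have hsum : e + (H - h) = H - (h - e) := by abel
  refine map_eq_self_of_map_add_eq hF he heE hhH ?_ hE hH ?_ ?_ h₂
  · rwa [sub_sub_cancel]
  · rw [hsum, map_sub, hH, heh]
  · rwa [sub_sub_cancel]

theorem map_eq_self_or_eq_add (hF : ∀ x ∈ effectiveClasses k G, F x ∈ effectiveClasses k G)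
    (he : e ∈ effectiveClasses k G) (hh : h ∈ effectiveClasses k G)
    (hs : s ∈ effectiveClasses k G) (hes : F (e + s) = e + s) (heh : F (h - e) = h - e)
    (h₁ : homPairing k G e h = 0) (h₂ : homPairing k G s s = 1) :
    F e = e ∨ F e = e + s ∧ F h = h + s := by
  have hFh : F h = h + (F e - e) := by
    rw [map_sub, sub_eq_iff_eq_add] at heh
    rw [heh]
    abel
  have hFs : F s = s - (F e - e) := by
    rw [map_add, ← eq_sub_iff_add_eq'] at hes
    rw [hes]
    abel
  have hd : F e - e ∈ effectiveClasses k G := mem_effectiveClasses_of_add_mem he hh h₁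
    ((add_sub_cancel e (F e)).symm ▸ hF e he) (hFh ▸ hF h hh)
  obtain h0 | h0 := eq_zero_or_eq_zero_of_homPairing_add_self_eq_one hd (hFs ▸ hF s hs)
    (by rwa [add_sub_cancel])
  · exact .inl (sub_eq_zero.1 h0)
  · rw [sub_eq_zero] at h0
    exact .inr ⟨by rw [h0, add_sub_cancel], by rw [hFh, h0]⟩

end Perturbation

section KoszulInduction

variable {k : Type u} [Field k]

theorem symClass_zero : symClass k 0 = 1 :=
  rfl

theorem symClass_one : symClass k 1 = xClass k :=
  rfl

variable [CharZero k]

theorem lambdaClass_zero : lambdaClass k 0 = 1 :=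
  congrArg (DirectSum.of (K0Deg k) 0) (signK0_eq_trivialK0 zero_le_one)

theorem lambdaClass_one : lambdaClass k 1 = xClass k :=
  (congrArg (DirectSum.of (K0Deg k) 1) (signK0_eq_trivialK0 le_rfl)).trans symClass_one

theorem symClass_add_lambdaClass_mem {R : Subring (TensorK0 k)} {N : ℕ} (hN : 0 < N)
    (hR : ∀ n < N, lambdaClass k n ∈ R ∧ symClass k n ∈ R) :
    symClass k N + (-1 : ℤ) ^ N • lambdaClass k N ∈ R := by
  have hsum := sum_lambdaClass_mul_symClass (k := k) hN
  have hsym : (0, N) ∈ Finset.HasAntidiagonal.antidiagonal N := by simp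
  have hlambda : (N, 0) ∈ (Finset.HasAntidiagonal.antidiagonal N).erase (0, N) := by
    simp [hN.ne']
  rw [← Finset.add_sum_erase _ _ hsym, ← Finset.add_sum_erase _ _ hlambda, ← add_assoc, pow_zero,
    one_zsmul, lambdaClass_zero, symClass_zero, one_mul, mul_one, add_eq_zero_iff_eq_neg] at hsum
  rw [hsum]
  refine neg_mem (sum_mem fun p hp => ?_)
  simp only [Finset.mem_erase, Finset.HasAntidiagonal.mem_antidiagonal, ne_eq, Prod.ext_iff] at hp
  exact zsmul_mem (mul_mem (hR p.1 (by lia)).1 (hR p.2 (by lia)).2) _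

theorem symClass_two : symClass k 2 = xClass k * xClass k - lambdaClass k 2 := by
  have hsum := sum_lambdaClass_mul_symClass (k := k) (N := 2) (by lia)
  simp only [Finset.Nat.sum_antidiagonal_eq_sum_range_succ_mk, Finset.sum_range_succ,
    Finset.sum_range_zero, Nat.reduceSub, tsub_zero, tsub_self, zero_add, lambdaClass_zero,
    lambdaClass_one, symClass_zero, symClass_one, zsmul_eq_mul] at hsum
  push_cast at hsum
  linear_combination hsum

theorem symClass_three :
    symClass k 3 = xClass k * symClass k 2 - lambdaClass k 2 * xClass k + lambdaClass k 3 := by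
  have hsum := sum_lambdaClass_mul_symClass (k := k) (N := 3) (by lia)
  simp only [Finset.Nat.sum_antidiagonal_eq_sum_range_succ_mk, Finset.sum_range_succ,
    Finset.sum_range_zero, Nat.reduceSub, tsub_zero, tsub_self, zero_add, lambdaClass_zero,
    lambdaClass_one, symClass_zero, symClass_one, zsmul_eq_mul] at hsum
  push_cast at hsum
  linear_combination hsum

theorem symClass_four : symClass k 4 = xClass k * symClass k 3 - lambdaClass k 2 * symClass k 2 +
    lambdaClass k 3 * xClass k - lambdaClass k 4 := by
  have hsum := sum_lambdaClass_mul_symClass (k := k) (N := 4) (by lia)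
  simp only [Finset.Nat.sum_antidiagonal_eq_sum_range_succ_mk, Finset.sum_range_succ,
    Finset.sum_range_zero, Nat.reduceSub, tsub_zero, tsub_self, zero_add, lambdaClass_zero,
    lambdaClass_one, symClass_zero, symClass_one, zsmul_eq_mul] at hsum
  push_cast at hsum
  linear_combination hsum

theorem mulHom_trivialK0_sub_eq_mulHom_signK0_sub :
    mulHom 2 1 (trivialK0 k 2) (trivialK0 k 1) - trivialK0 k 3 =
      mulHom 2 1 (signK0 k 2) (signK0 k 1) - signK0 k 3 := by
  apply DirectSum.of_injective (β := K0Deg k) 3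
  have hE := of_mul_of (signK0 k 2) (signK0 k 1)
  have hH := of_mul_of (trivialK0 k 2) (trivialK0 k 1)
  rw [map_sub, map_sub, ← hE, ← hH]
  change symClass k 2 * xClass k - symClass k 3 =
    lambdaClass k 2 * lambdaClass k 1 - lambdaClass k 3
  rw [lambdaClass_one, symClass_three]
  ring

end KoszulInduction

section InductionStep

variable {k : Type u} [Field k] [CharZero k]

theorem homPairing_mulHom_sub_mulHom_sub {m : ℕ} (n : ℕ) (hm : 1 < m) :
    homPairing k _ (mulHom m n (signK0 k m) (signK0 k n) - signK0 k (m + n))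
        (mulHom m n (trivialK0 k m) (trivialK0 k n) - trivialK0 k (m + n)) =
      homPairing k _ (mulHom m n (signK0 k m) (signK0 k n))
        (mulHom m n (trivialK0 k m) (trivialK0 k n)) := by
  simp only [map_sub, AddMonoidHom.sub_apply, homPairing_signK0_mulHom_trivialK0 n hm,
    homPairing_mulHom_signK0_trivialK0 n hm,
    homPairing_signK0_trivialK0 (hm.trans_le (Nat.le_add_right m n)), sub_zero]

theorem map_signK0_eq_self {M : ℕ} (hM : 3 ≤ M) {F : K0Deg k (M + 1) →+ K0Deg k (M + 1)}
    (hF : ∀ x ∈ effectiveClasses k _, F x ∈ effectiveClasses k _)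
    (hE : F (mulHom M 1 (signK0 k M) (signK0 k 1)) = mulHom M 1 (signK0 k M) (signK0 k 1))
    (hH : F (mulHom M 1 (trivialK0 k M) (trivialK0 k 1)) =
      mulHom M 1 (trivialK0 k M) (trivialK0 k 1))
    (hK : F (trivialK0 k (M + 1) + (-1 : ℤ) ^ (M + 1) • signK0 k (M + 1)) =
      trivialK0 k (M + 1) + (-1 : ℤ) ^ (M + 1) • signK0 k (M + 1)) :
    F (signK0 k (M + 1)) = signK0 k (M + 1) := by
  have he := signK0_mem_effectiveClasses (k := k) (M + 1)
  have hh := trivialK0_mem_effectiveClasses (k := k) (M + 1)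
  have hp := mulHom_signK0_sub_mem_effectiveClasses (k := k) M 1
  have hq := mulHom_trivialK0_sub_mem_effectiveClasses (k := k) M 1
  have heh := homPairing_signK0_trivialK0 (k := k) (n := M + 1) (by lia)
  have heH := homPairing_signK0_mulHom_trivialK0 (k := k) (m := M) 1 (by lia)
  have hEh := homPairing_mulHom_signK0_trivialK0 (k := k) (m := M) 1 (by lia)
  obtain hpar | hpar := Nat.even_or_odd (M + 1)
  · rw [hpar.neg_one_pow, one_zsmul, add_comm (trivialK0 k _)] at hK
    refine map_eq_self_of_map_add_eq hF he hp hh hq hE hH hK ?_ ?_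
    · rw [map_sub, heH, heh, sub_zero]
    · rw [map_sub, AddMonoidHom.sub_apply, hEh, heh, sub_zero]
  · rw [hpar.neg_one_pow, neg_one_zsmul, ← sub_eq_add_neg] at hK
    refine map_eq_self_of_map_sub_eq hF he hp hh hq hE hH hK heh ?_
    rw [homPairing_mulHom_sub_mulHom_sub 1 (by lia),
      homPairing_mulHom_signK0_mulHom_trivialK0 (by lia)]

theorem map_signK0_three_eq_self_or {F : K0Deg k 3 →+ K0Deg k 3}
    (hF : ∀ x ∈ effectiveClasses k _, F x ∈ effectiveClasses k _)
    (hE : F (mulHom 2 1 (signK0 k 2) (signK0 k 1)) = mulHom 2 1 (signK0 k 2) (signK0 k 1))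
    (hK : F (trivialK0 k 3 - signK0 k 3) = trivialK0 k 3 - signK0 k 3) :
    F (signK0 k 3) = signK0 k 3 ∨
      F (signK0 k 3) = mulHom 2 1 (signK0 k 2) (signK0 k 1) ∧
      F (trivialK0 k 3) = mulHom 2 1 (trivialK0 k 2) (trivialK0 k 1) := by
  have hss : homPairing k _ (mulHom 2 1 (signK0 k 2) (signK0 k 1) - signK0 k 3)
      (mulHom 2 1 (signK0 k 2) (signK0 k 1) - signK0 k 3) = 1 := by
    nth_rw 2 [← mulHom_trivialK0_sub_eq_mulHom_signK0_sub]
    exact (homPairing_mulHom_sub_mulHom_sub 1 one_lt_two).trans homPairing_mulHom_two_one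
  have hcases := map_eq_self_or_eq_add hF (signK0_mem_effectiveClasses 3)
    (trivialK0_mem_effectiveClasses 3) (mulHom_signK0_sub_mem_effectiveClasses 2 1)
    (by rwa [add_sub_cancel]) hK
    (homPairing_signK0_trivialK0 (by lia)) hss
  rwa [add_sub_cancel, ← mulHom_trivialK0_sub_eq_mulHom_signK0_sub, add_sub_cancel] at hcases

end InductionStep

section DegreePart

variable {ι F : Type*} [DecidableEq ι] {A : ι → Type*} [∀ i, AddCommMonoid (A i)]
  [FunLike F (⨁ i, A i) (⨁ i, A i)] [AddMonoidHomClass F (⨁ i, A i) (⨁ i, A i)]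

/-- The map induced in degree `i` by an endomorphism `f` of a graded additive monoid: the degree `i`
component of the restriction of `f` to the degree `i` part. -/
def degreePart (f : F) (i : ι) : A i →+ A i :=
  (DFinsupp.evalAddMonoidHom i).comp ((f : (⨁ i, A i) →+ ⨁ i, A i).comp (DirectSum.of A i))

theorem of_degreePart {f : F} {i : ι} {a : A i}
    (h : ∃ b, f (DirectSum.of A i a) = DirectSum.of A i b) :
    DirectSum.of A i (degreePart f i a) = f (DirectSum.of A i a) := by
  obtain ⟨b, hb⟩ := h
  have hab : degreePart f i a = b := (DFunLike.congr_fun hb i).trans (DirectSum.of_eq_same i b)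
  rw [hab, hb]

theorem degreePart_eq_iff {f : F} {i : ι} {a b : A i}
    (h : ∃ b, f (DirectSum.of A i a) = DirectSum.of A i b) :
    degreePart f i a = b ↔ f (DirectSum.of A i a) = DirectSum.of A i b := by
  rw [← of_degreePart h, (DirectSum.of_injective i).eq_iff]

end DegreePart

section Positivity

variable {k : Type u} [Field k] [CharZero k]

theorem of_mem_closure_simpleClasses {n : ℕ} {a : K0Deg k n} (ha : a ∈ effectiveClasses k _) :
    DirectSum.of (K0Deg k) n a ∈ AddSubmonoid.closure (simpleClasses k) := by
  rw [← closure_irreducibleClasses] at ha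
  induction ha using AddSubmonoid.closure_induction with
  | mem a ha =>
    obtain ⟨V, hV, rfl⟩ := ha
    exact AddSubmonoid.subset_closure ⟨n, V, hV, rfl⟩
  | zero => rw [map_zero]; exact zero_mem _
  | add a b _ _ ha hb => rw [map_add]; exact add_mem ha hb

theorem apply_mem_effectiveClasses {y : TensorK0 k}
    (hy : y ∈ AddSubmonoid.closure (simpleClasses k)) (n : ℕ) : y n ∈ effectiveClasses k _ := by
  induction hy using AddSubmonoid.closure_induction with
  | mem y hy =>
    obtain ⟨m, V, -, rfl⟩ := hy
    rw [cls]
    obtain rfl | hmn := eq_or_ne m n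
    · rw [DirectSum.of_eq_same]
      exact mk_mem_effectiveClasses V
    · rw [DirectSum.of_eq_of_ne _ _ _ hmn.symm]
      exact zero_mem _
  | zero => exact zero_mem _
  | add a b _ _ ha hb => exact add_mem ha hb

end Positivity

section FixedClasses

variable {k : Type u} [Field k] [CharZero k]

/-- The graded ring endomorphisms of `K₀(𝒯_k)` that map the class of every simple object to a
nonnegative integral combination of classes of simple objects. -/
structure IsGradedPositive (f : TensorK0 k →+* TensorK0 k) : Prop where
  exists_map_of_eq (n : ℕ) (a : K0Deg k n) :
    ∃ b, f (DirectSum.of (K0Deg k) n a) = DirectSum.of (K0Deg k) n b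
  map_mem_closure : ∀ s ∈ simpleClasses k, f s ∈ AddSubmonoid.closure (simpleClasses k)

variable {f : TensorK0 k →+* TensorK0 k}

theorem IsGradedPositive.degreePart_mem_effectiveClasses (hf : IsGradedPositive f) {n : ℕ}
    {a : K0Deg k n} (ha : a ∈ effectiveClasses k _) :
    degreePart f n a ∈ effectiveClasses k _ := by
  have hle : AddSubmonoid.closure (simpleClasses k) ≤
      (AddSubmonoid.closure (simpleClasses k)).comap f := AddSubmonoid.closure_le.2
        hf.map_mem_closure
  exact apply_mem_effectiveClasses (hle (of_mem_closure_simpleClasses ha)) n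

theorem IsGradedPositive.degreePart_eq_self_iff (hf : IsGradedPositive f) {n : ℕ} {a : K0Deg k n} :
    degreePart f n a = a ↔ DirectSum.of (K0Deg k) n a ∈ f.eqLocus (RingHom.id _) :=
  degreePart_eq_iff (hf.exists_map_of_eq n a)

theorem map_symClass_two (hx : f (xClass k) = xClass k)
    (hlambda : f (lambdaClass k 2) = lambdaClass k 2) : f (symClass k 2) = symClass k 2 := by
  rw [symClass_two, map_sub, map_mul, hx, hlambda]

theorem IsGradedPositive.map_symClass_three_ne (hf : IsGradedPositive f)
    (hx : f (xClass k) = xClass k) (hlambda : f (lambdaClass k 2) = lambdaClass k 2)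
    (he : f (lambdaClass k 3) = lambdaClass k 2 * xClass k) :
    f (symClass k 3) ≠ symClass k 2 * xClass k := by
  intro hh
  let F := degreePart f (2 + 2)
  have hsym := map_symClass_two hx hlambda
  have ha := hf.degreePart_mem_effectiveClasses (mulHom_signK0_sub_mem_effectiveClasses 2 2)
  have hb := hf.degreePart_mem_effectiveClasses (mulHom_trivialK0_sub_mem_effectiveClasses 2 2)
  have hsum : F (mulHom 2 2 (signK0 k 2) (signK0 k 2) - signK0 k (2 + 2)) +
      F (mulHom 2 2 (trivialK0 k 2) (trivialK0 k 2) - trivialK0 k (2 + 2)) =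
        -mulHom 2 2 (signK0 k 2) (trivialK0 k 2) := by
    rw [← map_add]
    refine (degreePart_eq_iff (hf.exists_map_of_eq _ _)).2 ?_
    rw [map_add, map_sub, map_sub, map_neg, ← of_mul_of, ← of_mul_of, ← of_mul_of]
    change f (lambdaClass k 2 * lambdaClass k 2 - lambdaClass k 4 +
      (symClass k 2 * symClass k 2 - symClass k 4)) = -(lambdaClass k 2 * symClass k 2)
    rw [symClass_four]
    simp only [map_add, map_sub, map_mul, hx, hlambda, hsym, he, hh]
    linear_combination (symClass k 2 + lambdaClass k 2) * symClass_two (k := k)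
  refine mulHom_signK0_trivialK0_ne_zero (k := k) 2 2
    (eq_zero_of_mem_of_neg_mem_effectiveClasses (mulHom_mem_effectiveClasses
      (signK0_mem_effectiveClasses 2) (trivialK0_mem_effectiveClasses 2)) ?_)
  exact hsum ▸ add_mem ha hb

theorem IsGradedPositive.map_lambdaClass_three (hf : IsGradedPositive f)
    (hx : f (xClass k) = xClass k) (hlambda : f (lambdaClass k 2) = lambdaClass k 2) :
    f (lambdaClass k 3) = lambdaClass k 3 := by
  have hsym := map_symClass_two hx hlambda
  have hmul : DirectSum.of (K0Deg k) 3 (mulHom 2 1 (signK0 k 2) (signK0 k 1)) =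
      lambdaClass k 2 * xClass k := by
    rw [← lambdaClass_one]
    exact (of_mul_of (signK0 k 2) (signK0 k 1)).symm
  have hmul' : DirectSum.of (K0Deg k) 3 (mulHom 2 1 (trivialK0 k 2) (trivialK0 k 1)) =
      symClass k 2 * xClass k :=
    (of_mul_of (trivialK0 k 2) (trivialK0 k 1)).symm
  have hE : degreePart f 3 (mulHom 2 1 (signK0 k 2) (signK0 k 1)) =
      mulHom 2 1 (signK0 k 2) (signK0 k 1) := by
    rw [hf.degreePart_eq_self_iff, hmul, RingHom.mem_eqLocus, map_mul, map_mul, hx, hlambda]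
    rfl
  have hK : degreePart f 3 (trivialK0 k 3 - signK0 k 3) =
      trivialK0 k 3 - signK0 k 3 := by
    rw [hf.degreePart_eq_self_iff, map_sub]
    change f (symClass k 3 - lambdaClass k 3) = symClass k 3 - lambdaClass k 3
    rw [symClass_three, add_sub_cancel_right, map_sub, map_mul, map_mul, hx, hlambda, hsym]
  obtain h | ⟨he, hh⟩ := map_signK0_three_eq_self_or
    (fun a ha => hf.degreePart_mem_effectiveClasses ha) hE hK
  · exact hf.degreePart_eq_self_iff.1 h
  · refine absurd ?_ (hf.map_symClass_three_ne hx hlambda ?_)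
    · exact ((degreePart_eq_iff (hf.exists_map_of_eq 3 _)).1 hh).trans hmul'
    · exact ((degreePart_eq_iff (hf.exists_map_of_eq 3 _)).1 he).trans hmul

theorem IsGradedPositive.lambdaClass_succ_mem_eqLocus (hf : IsGradedPositive f) {M : ℕ} (hM : 3 ≤ M)
    (hfix : ∀ n < M + 1, lambdaClass k n ∈ f.eqLocus (RingHom.id _) ∧
      symClass k n ∈ f.eqLocus (RingHom.id _)) :
    lambdaClass k (M + 1) ∈ f.eqLocus (RingHom.id _) := by
  refine hf.degreePart_eq_self_iff.1 (map_signK0_eq_self hM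
    (fun _ => hf.degreePart_mem_effectiveClasses) ?_ ?_ ?_)
  · rw [hf.degreePart_eq_self_iff, ← of_mul_of]
    exact mul_mem (hfix M (by lia)).1 (hfix 1 (by lia)).1
  · rw [hf.degreePart_eq_self_iff, ← of_mul_of]
    exact mul_mem (hfix M (by lia)).2 (hfix 1 (by lia)).2
  · rw [hf.degreePart_eq_self_iff, map_add, map_zsmul]
    exact symClass_add_lambdaClass_mem M.succ_pos hfix

theorem IsGradedPositive.lambdaClass_symClass_mem_eqLocus (hf : IsGradedPositive f)
    (hx : f (xClass k) = xClass k) (hlambda : f (lambdaClass k 2) = lambdaClass k 2) (n : ℕ) :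
    lambdaClass k n ∈ f.eqLocus (RingHom.id _) ∧ symClass k n ∈ f.eqLocus (RingHom.id _) := by
  induction n using Nat.strong_induction_on with
  | h n ih =>
    have hlam : lambdaClass k n ∈ f.eqLocus (RingHom.id _) := by
      match n with
      | 0 => exact lambdaClass_zero (k := k) ▸ one_mem _
      | 1 => exact lambdaClass_one (k := k) ▸ hx
      | 2 => exact hlambda
      | 3 => exact hf.map_lambdaClass_three hx hlambda
      | M + 4 => exact hf.lambdaClass_succ_mem_eqLocus (Nat.le_add_left 3 M) ih
    obtain rfl | hn := n.eq_zero_or_pos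
    · exact ⟨hlam, symClass_zero (k := k) ▸ one_mem _⟩
    · exact ⟨hlam, (add_mem_cancel_right (zsmul_mem hlam _)).1 (symClass_add_lambdaClass_mem hn ih)⟩

theorem eq_id_of_symClass_mem_eqLocus
    (hgraded : ∀ (n : ℕ) (a : K0Deg k n),
      ∃ b, f (DirectSum.of (K0Deg k) n a) = DirectSum.of (K0Deg k) n b)
    (hsym : ∀ n, symClass k n ∈ f.eqLocus (RingHom.id _)) : f = RingHom.id _ := by
  have hfix (n : ℕ) : degreePart f n - AddMonoidHom.id (K0Deg k n) = 0 := by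
    refine addMonoidHom_eq_zero_of_map_eq_zero fun α c => ?_
    obtain ⟨a, ha, hac⟩ := exists_mem_charHom_eq_indChar_one _
      (fun m => ⟨trivialK0 k m, hsym m, charHom_trivialK0 m⟩) c
    exact ⟨a, hac, sub_eq_zero.2 ((degreePart_eq_iff (hgraded n a)).2 ha)⟩
  have hadd : (f : TensorK0 k →+ TensorK0 k) = AddMonoidHom.id _ := DirectSum.addHom_ext
    fun n a => (degreePart_eq_iff (hgraded n a)).1 (sub_eq_zero.1 (DFunLike.congr_fun (hfix n) a))
  exact RingHom.ext fun y => DFunLike.congr_fun hadd y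

end FixedClasses

end FreeTensor

end


/-- Let `f` be a graded ring endomorphism of the Grothendieck ring `K₀(𝒯_k)` of the free tensor
category that fixes `x` and `λ²x` and sends the class of each simple object to a linear combination,
with non-negative integer coefficients, of classes of simple objects. Then `f` is the identity. -/
theorem mainTheorem3 (k : Type u) [Field k] [CharZero k]
    (f : FreeTensor.TensorK0 k →+* FreeTensor.TensorK0 k)
    (hgraded : ∀ (n : ℕ) (a : FreeTensor.K0Deg k n), ∃ b : FreeTensor.K0Deg k n,
      f (DirectSum.of (FreeTensor.K0Deg k) n a) = DirectSum.of (FreeTensor.K0Deg k) n b)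
    (hx : f (FreeTensor.xClass k) = FreeTensor.xClass k)
    (hlambda : f (FreeTensor.lambdaClass k 2) = FreeTensor.lambdaClass k 2)
    (hpos : ∀ s ∈ FreeTensor.simpleClasses k,
      f s ∈ AddSubmonoid.closure (FreeTensor.simpleClasses k)) :
    f = RingHom.id (FreeTensor.TensorK0 k) := by
  have hf : FreeTensor.IsGradedPositive f := ⟨hgraded, hpos⟩
  exact FreeTensor.eq_id_of_symClass_mem_eqLocus hgraded fun n =>
    (hf.lambdaClass_symClass_mem_eqLocus hx hlambda n).2
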